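/- **Theorem 2.4 (Increasing FP potential implies low-degree hardness).** *Setting.* For every $n$ let $P_n$ be a probability measure on $\mathbb R^n$ (the prior), let $X,X'\sim P_n$ be independent, and consider the Gaussian additive model $Y=\sqrt{\lambda}\,X+Z$ with $Z\sim N(0,I_n)$ independent of $X$ and signal-to-noise ratio $\lambda>0$. Put $$\mathrm{Corr}^{\le D}_{P_n}(\lambda)^2=\sum_{i=1}^n\ \sup\Big\{\mathbb E[g(Y)X_i]^2:\ g\in\mathbb R[y_1,\dots,y_n],\ \deg g\le D,\ \mathbb E[g(Y)^2]=1\Big\},$$ $$q(D)=q_n(D)=\inf\{y\in\mathbb R:\ \mathbb P(|\langle X,X'\rangle|\le y)\ge 1-e^{-D}\}\qquad(D>0).$$ Let $(D_n)$, $(D_n')$ be sequences of positive integers, $(A_n)$ a sequence of positive reals and $C>0$ a constant, with $D_n\le n^C$, $D_n'=(1+o(1))D_n\log^2 n$ and $D_n'\ge D_n\log^2 n$ for all large $n$. Assume that for all large $n$ the overlap $\langle X,X'\rangle$ has a probability density $f_n$ which is positive and differentiable at $q(D_n)$. The annealed Franz–Parisi potential is $\mathcal F_{\mathrm{ann},\lambda}(q)=-\log\big(e^{\lambda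 q}f_n(q)\big)$, and $\mathcal F'_{\mathrm{ann},\lambda}$ denotes its derivative in $q$. Assume moreover that there are constants $\phi,K,C_1>0$, not depending on $n$, such that for all large $n$: 1. for every multi-index $\alpha\in\mathbb Z_{\ge0}^n$ with $1\le|\alpha|\le D_n$, the joint cumulant $\kappa_\alpha(X_1,\dots,X_n)$ (of $\alpha_i$ copies of $X_i$ for each $i$) is nonnegative; here the joint cumulant of $Y_1,\dots,Y_m$ is $\sum_\pi(-1)^{|\pi|-1}(|\pi|-1)!\prod_{B\in\pi}\mathbb E\big[\prod_{i\in B}Y_i\big]$, summed over the set partitions $\pi$ of $\{1,\dots,m\}$; 2. each marginal is sub-Weibull of order $\phi$: $(\mathbb E|X_i|^p)^{1/p}\le K p^{1/\phi}$ for all $i\le n$ and all real $p\ge1$; 3. $q(D_n\log^2 n)\ge\max\{(\log n)^{-D_n/2},\,n^{-C_1}\}$; 4. $\dfrac{d}{dt}\log f_n(t)\Big|_{t=q(D_n)}\ \ge\ -\dfrac{A_n}{q(D_n\log^2 n)\,\log n}$. *Conclusion.* There is $n_0$ such that for all $n\ge n_0$ and every $u>0$ with $u+\mathcal F'_{\mathrm{ann},u}(q(D_n))>0$,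 $$\mathrm{Corr}^{\le D_n}_{P_n}\Big(\tfrac1{A_n}\big(u+\mathcal F'_{\mathrm{ann},u}(q(D_n))\big)\Big)^2\ \le\ 2\,q(D_n').$$ In particular, for any sequence $\lambda=\lambda_n>0$ and all sufficiently large $n$, $\mathcal F'_{\mathrm{ann},\lambda}(q(D_n))\ge0$ implies $\mathrm{Corr}^{\le D_n}_{P_n}(\lambda/A_n)^2\le 2\,q(D_n')$. -/

import Mathlib

noncomputable section

namespace GaussianAdditive

open MeasureTheory ProbabilityTheory

/-- The law of the overlap `⟨X, X'⟩` of two independent draws `X, X'` from the prior `P`. -/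
def overlapLaw {n : ℕ} (P : Measure (Fin n → ℝ)) : Measure ℝ :=
  (P.prod P).map fun x => ∑ i, x.1 i * x.2 i

/-- The quantile `q(D) = inf {y : ℙ(|⟨X, X'⟩| ≤ y) ≥ 1 - e^{-D}}` of the absolute overlap. -/
def overlapQuantile {n : ℕ} (P : Measure (Fin n → ℝ)) (D : ℝ) : ℝ :=
  sInf {y : ℝ | 1 - Real.exp (-D) ≤ (overlapLaw P).real {s | |s| ≤ y}}

/-- `f` is a version of the probability density function of the overlap `⟨X, X'⟩`. -/
structure IsOverlapPDF {n : ℕ} (P : Measure (Fin n → ℝ)) (f : ℝ → ℝ) : Prop where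
  measurable : Measurable f
  nonneg : ∀ t, 0 ≤ f t
  law_eq : overlapLaw P = volume.withDensity fun t => ENNReal.ofReal (f t)

/-- The annealed Franz-Parisi potential `-log 𝔼[1_{⟨X, X'⟩ = q} exp (lam * ⟨X, X'⟩)]`, where the
expectation over the event `⟨X, X'⟩ = q` is read as a density, `f` being the PDF of the overlap. -/
def annealedFP (f : ℝ → ℝ) (lam q : ℝ) : ℝ :=
  -Real.log (Real.exp (lam * q) * f q)

/-- The joint cumulant `κ(Y_i : i ∈ ι)` of a finite family of random variables having moments of
all orders: the sum over the set partitions `π` of `ι` of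
`(-1)^(|π| - 1) * (|π| - 1)! * ∏_{B ∈ π} 𝔼[∏_{i ∈ B} Y_i]`. Only nonempty `ι` matter. -/
def jointCumulant {Ω ι : Type*} [MeasurableSpace Ω] [Fintype ι] [DecidableEq ι]
    (μ : Measure Ω) (Y : ι → Ω → ℝ) : ℝ :=
  ∑ π : Finpartition (Finset.univ : Finset ι),
    (-1) ^ (π.parts.card - 1) * ((π.parts.card - 1).factorial : ℝ) *
      ∏ B ∈ π.parts, ∫ ω, ∏ i ∈ B, Y i ω ∂μ

/-- `κ_α(X_1, …, X_n)` for `X ∼ P`: the joint cumulant of the family that contains `α i` copies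
of the coordinate `X_i`, for every `i`. -/
def cumulant {n : ℕ} (P : Measure (Fin n → ℝ)) (α : Fin n → ℕ) : ℝ :=
  jointCumulant P fun (s : Σ i : Fin n, Fin (α i)) (x : Fin n → ℝ) => x s.1

/-- `X` is sub-Weibull of order `φ` with constant `K`: `(𝔼 |X|^p)^(1/p) ≤ K * p^(1/φ)` for all
real `p ≥ 1`. -/
def IsSubWeibull {Ω : Type*} [MeasurableSpace Ω] (φ K : ℝ) (X : Ω → ℝ) (μ : Measure Ω) : Prop :=
  ∀ p : ℝ, 1 ≤ p → eLpNorm X (ENNReal.ofReal p) μ ≤ ENNReal.ofReal (K * p ^ (1 / φ))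

/-- The joint law of the signal `X ∼ P` and an independent noise vector `Z ∼ N(0, I_n)`. -/
def signalNoiseLaw {n : ℕ} (P : Measure (Fin n → ℝ)) :
    Measure ((Fin n → ℝ) × (Fin n → ℝ)) :=
  P.prod (Measure.pi fun _ => gaussianReal 0 1)

/-- The observation `Y = √lam * X + Z` at signal-to-noise ratio `lam`, as a function of `(X, Z)`. -/
def observation {n : ℕ} (lam : ℝ) (ω : (Fin n → ℝ) × (Fin n → ℝ)) : Fin n → ℝ :=
  fun j => √lam * ω.1 j + ω.2 j

/-- The degree-`D` correlation
`√(∑_i sup {𝔼[g(Y) X_i]² : g a polynomial of degree at most D with 𝔼[g(Y)²] = 1})`. -/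
def lowDegreeCorr {n : ℕ} (P : Measure (Fin n → ℝ)) (D : ℕ) (lam : ℝ) : ℝ :=
  √(∑ i : Fin n, sSup {c : ℝ | ∃ g : MvPolynomial (Fin n) ℝ, g.totalDegree ≤ D ∧
    ∫ ω, (MvPolynomial.eval (observation lam ω) g) ^ 2 ∂(signalNoiseLaw P) = 1 ∧
    c = (∫ ω, MvPolynomial.eval (observation lam ω) g * ω.1 i ∂(signalNoiseLaw P)) ^ 2})

/-- The overlap has a density `f n` which, for `n` large, is positive and differentiable at the
quantile `q(D n)`, so that the logarithmic derivatives below make sense. -/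
def HasRegularOverlapPDF (P : ∀ n : ℕ, Measure (Fin n → ℝ)) (f : ℕ → ℝ → ℝ) (D : ℕ → ℕ) : Prop :=
  ∀ᶠ n : ℕ in Filter.atTop, IsOverlapPDF (P n) (f n) ∧
    0 < f n (overlapQuantile (P n) (D n)) ∧
    DifferentiableAt ℝ (f n) (overlapQuantile (P n) (D n))

/-- Low-order cumulant-nonnegative Gaussian additive models, with parameters `D`, `A` and `C`.
`P n` is the prior on `ℝ^n` and `f n` the PDF of the overlap. The conditions are asymptotic: they
are imposed for all large `n`, with `C`, `φ`, `K`, `C₁` not depending on `n`. -/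
structure IsLowOrderCumulantNonneg (P : ∀ n : ℕ, Measure (Fin n → ℝ)) (f : ℕ → ℝ → ℝ)
    (D : ℕ → ℕ) (A : ℕ → ℝ) (C : ℝ) : Prop where
  C_pos : 0 < C
  D_pos : ∀ n, 0 < D n
  D_le : ∀ᶠ n : ℕ in Filter.atTop, (D n : ℝ) ≤ (n : ℝ) ^ C
  A_pos : ∀ n, 0 < A n
  /-- nonnegative joint cumulants of order at most `D n` -/
  cumulant_nonneg : ∀ᶠ n : ℕ in Filter.atTop, ∀ α : Fin n → ℕ, 1 ≤ ∑ i, α i → ∑ i, α i ≤ D n →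
    0 ≤ cumulant (P n) α
  /-- sub-Weibull marginals -/
  subWeibull : ∃ φ : ℝ, 0 < φ ∧ ∃ K : ℝ, 0 < K ∧ ∀ᶠ n : ℕ in Filter.atTop, ∀ i : Fin n,
    IsSubWeibull φ K (fun x : Fin n → ℝ => x i) (P n)
  /-- controlled decay of the overlap quantiles -/
  quantile_decay : ∃ C₁ : ℝ, 0 < C₁ ∧ ∀ᶠ n : ℕ in Filter.atTop,
    max (Real.log n ^ (-(D n : ℝ) / 2)) ((n : ℝ) ^ (-C₁)) ≤
      overlapQuantile (P n) (D n * Real.log n ^ 2)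
  /-- quantile stability -/
  quantile_stability : ∀ᶠ n : ℕ in Filter.atTop,
    -(A n / (overlapQuantile (P n) (D n * Real.log n ^ 2) * Real.log n)) ≤
      deriv (fun t => Real.log (f n t)) (overlapQuantile (P n) (D n))

end GaussianAdditive

end

/-!
A polynomial of degree at most `D` correlates with `X_i` exactly as it correlates with the noise
polynomial whose Hermite coefficients are the rescaled cumulants `κ(X_i, X^α)`, `|α| ≤ D`: the
moment-cumulant recursion says precisely this for Hermite polynomials. By Cauchy-Schwarz, `Corr²` is
at most `∑_α λ^|α| ∑_i κ(X_i, X^α)² / α!`. When the cumulants are nonnegative, the recursion bounds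
each by the moment of the same order (for the order `D + 1`, where no sign is known, up to products
of lower moments), and the squared moments of a given order add up to a moment of the overlap,
`∑_{|α| = k} k! / α! * 𝔼[X^α]² = 𝔼⟨X, X'⟩^k`. Truncating the overlap at its quantile `q` of level
`D log² n` costs a factor `exp (-D log² n / 2)`, which beats the sub-Weibull moments, so
`𝔼⟨X, X'⟩^k` is about `q^k` for `k ≤ D + 1` and the sum is geometric with ratio about `λ q`.
Quantile stability turns `u + F' ≥ 0` into `λ q ≤ 1 / log n` for the rescaled `λ = (u + F') / A`.
-/

namespace GaussianAdditive

open MeasureTheory ProbabilityTheory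

section Moments

/-- `f` lies in every `L^p` with `p` finite; natural exponents are enough. -/
def HasAllMoments {Ω : Type*} [MeasurableSpace Ω] (f : Ω → ℝ) (μ : Measure Ω) : Prop :=
  ∀ p : ℕ, MemLp f p μ

namespace HasAllMoments

open Polynomial

variable {Ω Ω' : Type*} [MeasurableSpace Ω] [MeasurableSpace Ω'] {μ : Measure Ω}
  {ν : Measure Ω'} {f g : Ω → ℝ}

lemma const [IsFiniteMeasure μ] (c : ℝ) : HasAllMoments (fun _ : Ω => c) μ :=
  fun _ => memLp_const c

lemma add (hf : HasAllMoments f μ) (hg : HasAllMoments g μ) :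
    HasAllMoments (fun x => f x + g x) μ := fun p => (hf p).add (hg p)

lemma mul (hf : HasAllMoments f μ) (hg : HasAllMoments g μ) :
    HasAllMoments (fun x => f x * g x) μ := fun p => by
  have h : ENNReal.HolderTriple ((2 * p : ℕ) : ENNReal) ((2 * p : ℕ) : ENNReal) (p : ENNReal) := by
    constructor
    push_cast
    rw [ENNReal.mul_inv (by simp) (by simp), ← add_mul, ENNReal.inv_two_add_inv_two, one_mul]
  exact (hg (2 * p)).mul (hf (2 * p)) (hpqr := h)

lemma const_mul (hf : HasAllMoments f μ) (c : ℝ) : HasAllMoments (fun x => c * f x) μ :=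
  fun p => (hf p).const_mul c

lemma pow [IsFiniteMeasure μ] (hf : HasAllMoments f μ) (k : ℕ) :
    HasAllMoments (fun x => f x ^ k) μ := by
  induction k with
  | zero => simpa using const 1
  | succ k ih => simpa only [pow_succ] using ih.mul hf

lemma prod [IsFiniteMeasure μ] {ι : Type*} {s : Finset ι} {F : ι → Ω → ℝ}
    (hF : ∀ i ∈ s, HasAllMoments (F i) μ) : HasAllMoments (fun x => ∏ i ∈ s, F i x) μ := by
  classical
  induction s using Finset.induction_on with
  | empty => simpa using const 1
  | insert a s ha ih =>
    simp only [Finset.prod_insert ha]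
    exact (hF a (by simp)).mul (ih fun i hi => hF i (by simp [hi]))

lemma sum [IsFiniteMeasure μ] {ι : Type*} {s : Finset ι} {F : ι → Ω → ℝ}
    (hF : ∀ i ∈ s, HasAllMoments (F i) μ) : HasAllMoments (fun x => ∑ i ∈ s, F i x) μ :=
  fun p => memLp_finsetSum s fun i hi => hF i hi p

lemma polynomial [IsFiniteMeasure μ] (hf : HasAllMoments f μ) (p : ℝ[X]) :
    HasAllMoments (fun x => p.eval (f x)) μ := by
  simp only [eval_eq_sum_range]
  exact sum fun i _ => (hf.pow i).const_mul _

lemma mvPolynomial [IsFiniteMeasure μ] {ι : Type*} {F : Ω → ι → ℝ}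
    (hF : ∀ i, HasAllMoments (fun x => F x i) μ) (p : MvPolynomial ι ℝ) :
    HasAllMoments (fun x => MvPolynomial.eval (F x) p) μ := by
  simp only [MvPolynomial.eval_eq]
  exact sum fun i _ => (prod fun j _ => (hF j).pow _).const_mul _

lemma integrable (hf : HasAllMoments f μ) : Integrable f μ :=
  memLp_one_iff_integrable.mp (by simpa using hf 1)

lemma comp (hf : HasAllMoments f μ) {φ : Ω' → Ω} (hφ : MeasurePreserving φ ν μ) :
    HasAllMoments (fun x => f (φ x)) ν := fun p => (hf p).comp_measurePreserving hφ

end HasAllMoments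

lemma sq_integral_mul_le {Ω : Type*} [MeasurableSpace Ω] {μ : Measure Ω} {f g : Ω → ℝ}
    (hf : MemLp f 2 μ) (hg : MemLp g 2 μ) :
    (∫ x, f x * g x ∂μ) ^ 2 ≤ (∫ x, f x ^ 2 ∂μ) * ∫ x, g x ^ 2 ∂μ := by
  have hHolder := integral_mul_norm_le_Lp_mul_Lq Real.HolderConjugate.two_two
    (by simpa using hf) (by simpa using hg)
  simp only [Real.norm_eq_abs, Real.rpow_two, sq_abs, ← Real.sqrt_eq_rpow] at hHolder
  have habs : |∫ x, f x * g x ∂μ| ≤ √(∫ x, f x ^ 2 ∂μ) * √(∫ x, g x ^ 2 ∂μ) :=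
    (abs_integral_le_integral_abs.trans (by simp only [abs_mul, le_refl])).trans hHolder
  rw [← sq_abs]
  calc |∫ x, f x * g x ∂μ| ^ 2 ≤ (√(∫ x, f x ^ 2 ∂μ) * √(∫ x, g x ^ 2 ∂μ)) ^ 2 := by gcongr
    _ = (∫ x, f x ^ 2 ∂μ) * ∫ x, g x ^ 2 ∂μ := by
      rw [mul_pow, Real.sq_sqrt (integral_nonneg fun x => sq_nonneg _),
        Real.sq_sqrt (integral_nonneg fun x => sq_nonneg _)]

end Moments

section Hermite

open Polynomial

lemma hasAllMoments_gaussianReal : HasAllMoments (fun x : ℝ => x) (gaussianReal 0 1) :=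
  fun p => memLp_id_gaussianReal' (μ := 0) (v := 1) (p : ENNReal) (by simp)

lemma hasDerivAt_gaussianPDFReal (x : ℝ) :
    HasDerivAt (gaussianPDFReal 0 1) (-x * gaussianPDFReal 0 1 x) x := by
  have h : gaussianPDFReal 0 1 =
      fun x : ℝ => (√(2 * Real.pi))⁻¹ * Real.exp (-x ^ 2 / 2) := by
    ext y; simp [gaussianPDFReal]
  rw [h]
  have h1 : HasDerivAt (fun x : ℝ => -x ^ 2 / 2) (-x) x := by
    refine (((hasDerivAt_pow 2 x).neg).div_const 2).congr_deriv ?_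
    simp [neg_div]
  refine (h1.exp.const_mul (√(2 * Real.pi))⁻¹).congr_deriv ?_
  ring

lemma integrable_gaussianPDFReal_mul_eval (p : ℝ[X]) :
    Integrable fun x : ℝ => gaussianPDFReal 0 1 x * p.eval x := by
  have h := (hasAllMoments_gaussianReal.polynomial p).integrable
  rw [gaussianReal_of_var_ne_zero _ one_ne_zero,
    integrable_withDensity_iff_integrable_smul' (measurable_gaussianPDF _ _)
      (Filter.Eventually.of_forall fun _ => gaussianPDF_lt_top)] at h
  simpa using h

lemma integral_id_mul_eval_gaussianReal (p : ℝ[X]) :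
    ∫ x, x * p.eval x ∂gaussianReal 0 1 = ∫ x, p.derivative.eval x ∂gaussianReal 0 1 := by
  rw [integral_gaussianReal_eq_integral_smul one_ne_zero,
    integral_gaussianReal_eq_integral_smul one_ne_zero, eq_comm, ← sub_eq_zero]
  have hX := integrable_gaussianPDFReal_mul_eval (X * p)
  have hd := integrable_gaussianPDFReal_mul_eval (derivative p)
  simp only [eval_mul, eval_X] at hX
  simp only [smul_eq_mul]
  rw [← integral_sub hd hX]
  refine integral_eq_zero_of_hasDerivAt_of_integrable
    (f := fun x => gaussianPDFReal 0 1 x * p.eval x) (fun x => ?_) (hd.sub hX)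
    (integrable_gaussianPDFReal_mul_eval p)
  refine ((hasDerivAt_gaussianPDFReal x).mul (p.hasDerivAt x)).congr_deriv ?_
  ring

/-- The probabilists' Hermite polynomials with real coefficients. -/
noncomputable def hermiteReal (k : ℕ) : ℝ[X] := (hermite k).map (Int.castRingHom ℝ)

@[simp] lemma hermiteReal_zero : hermiteReal 0 = 1 := by simp [hermiteReal]

lemma hermiteReal_succ (k : ℕ) :
    hermiteReal (k + 1) = X * hermiteReal k - derivative (hermiteReal k) := by
  simp [hermiteReal, hermite_succ, derivative_map]

lemma derivative_hermiteReal_succ (k : ℕ) :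
    derivative (hermiteReal (k + 1)) = C ((k : ℝ) + 1) * hermiteReal k := by
  induction k with
  | zero => simp [hermiteReal_succ]
  | succ k ih =>
    rw [hermiteReal_succ (k + 1), derivative_sub, derivative_mul, ih, derivative_mul,
      hermiteReal_succ k]
    simp only [derivative_X, one_mul, map_add, map_natCast, map_one, derivative_natCast,
      derivative_one, add_zero, zero_mul, zero_add, Nat.cast_add, Nat.cast_one]
    ring

lemma integral_hermiteReal_succ_mul (b : ℕ) (p : ℝ[X]) :
    ∫ x, (hermiteReal (b + 1)).eval x * p.eval x ∂gaussianReal 0 1 =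
      ∫ x, (hermiteReal b).eval x * p.derivative.eval x ∂gaussianReal 0 1 := by
  have hint (q : ℝ[X]) := (hasAllMoments_gaussianReal.polynomial q).integrable
  have h := integral_id_mul_eval_gaussianReal (hermiteReal b * p)
  have e : (fun x => (hermiteReal (b + 1)).eval x * p.eval x) = fun x =>
      (X * (hermiteReal b * p)).eval x - (derivative (hermiteReal b) * p).eval x := by
    ext x
    simp only [hermiteReal_succ, eval_sub, eval_mul, eval_X]
    ring
  rw [e, integral_sub (hint _) (hint _)]
  simp only [eval_mul, eval_X] at h ⊢
  rw [h, ← integral_sub (hint _) (by simpa using hint (derivative (hermiteReal b) * p))]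
  simp

lemma integral_hermiteReal_mul (b : ℕ) (p : ℝ[X]) :
    ∫ x, (hermiteReal b).eval x * p.eval x ∂gaussianReal 0 1 =
      ∫ x, (derivative^[b] p).eval x ∂gaussianReal 0 1 := by
  induction b generalizing p with
  | zero => simp
  | succ b ih => rw [integral_hermiteReal_succ_mul, ih, Function.iterate_succ_apply]

lemma iterate_derivative_hermiteReal (a b : ℕ) :
    derivative^[b] (hermiteReal a) = C (a.descFactorial b : ℝ) * hermiteReal (a - b) := by
  induction b generalizing a with
  | zero => simp
  | succ b ih =>
    cases a with
    | zero => simp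
    | succ a =>
      rw [Function.iterate_succ_apply, derivative_hermiteReal_succ,
        iterate_derivative_C_mul, ih, Nat.succ_descFactorial_succ]
      simp [mul_assoc]

lemma iterate_derivative_comp_C_add_X (t : ℝ) (p : ℝ[X]) (b : ℕ) :
    derivative^[b] (p.comp (C t + X)) = (derivative^[b] p).comp (C t + X) := by
  induction b generalizing p with
  | zero => rfl
  | succ b ih => simp [derivative_comp, ih]

lemma integral_hermiteReal_comp (c : ℕ) (t : ℝ) :
    ∫ x, (hermiteReal c).eval (t + x) ∂gaussianReal 0 1 = t ^ c := by
  induction c with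
  | zero => simp
  | succ c ih =>
    have hint (q : ℝ[X]) := (hasAllMoments_gaussianReal.polynomial q).integrable
    set q := (hermiteReal c).comp (C t + X) with hq
    have e : (fun x => (hermiteReal (c + 1)).eval (t + x)) = fun x =>
        t * q.eval x + ((X * q).eval x - (derivative q).eval x) := by
      ext x
      simp only [hermiteReal_succ, eval_sub, eval_mul, eval_X, hq, eval_comp, eval_add, eval_C,
        derivative_comp, derivative_add, derivative_C, derivative_X, zero_add, one_mul]
      ring
    have hs : Integrable (fun x => (X * q).eval x - (derivative q).eval x) (gaussianReal 0 1) :=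
      (hint _).sub (hint _)
    rw [e, integral_add ((hint _).const_mul _) hs, integral_sub (hint _) (hint _)]
    have h := integral_id_mul_eval_gaussianReal q
    simp only [eval_mul, eval_X, h, integral_const_mul, sub_self, add_zero]
    simp only [hq, eval_comp, eval_add, eval_C, eval_X, ih, pow_succ']

lemma integral_hermiteReal_mul_hermiteReal_comp (a b : ℕ) (t : ℝ) :
    ∫ x, (hermiteReal b).eval x * (hermiteReal a).eval (t + x) ∂gaussianReal 0 1 =
      a.descFactorial b * t ^ (a - b) := by
  have h := integral_hermiteReal_mul b ((hermiteReal a).comp (C t + X))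
  rw [iterate_derivative_comp_C_add_X, iterate_derivative_hermiteReal] at h
  simpa [integral_const_mul, integral_hermiteReal_comp] using h

lemma exists_eq_sum_hermiteReal {k : ℕ} {p : ℝ[X]} (hp : p.natDegree ≤ k) :
    ∃ c : ℕ → ℝ, p = ∑ a ∈ Finset.range (k + 1), c a • hermiteReal a := by
  let S : Sequence ℝ := ⟨hermiteReal, fun i => by
    rw [hermiteReal, (hermite_monic i).degree_map, degree_hermite]⟩
  have hS (i : ℕ) : (S i).Monic := (hermite_monic i).map _
  have hspan : p ∈ Submodule.span ℝ (S '' (Finset.range (k + 1) : Set ℕ)) := by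
    rw [Finset.coe_range, S.span_degreeLT fun i _ => by simp [(hS i).leadingCoeff], mem_degreeLT]
    exact degree_le_natDegree.trans_lt (by exact_mod_cast Nat.lt_succ_of_le hp)
  obtain ⟨c, hc⟩ := (Submodule.mem_span_image_finset_iff_exists_fun' ℝ).mp hspan
  exact ⟨c, hc.symm⟩

end Hermite

section Cumulants

open Finset

variable {ι : Type*} [DecidableEq ι]

lemma sup_erase_parts {A B : Finset ι} (π : Finpartition A) (hB : B ∈ π.parts) :
    (π.parts.erase B).sup id = A \ B := by
  ext a
  simp only [mem_sup, mem_erase, mem_sdiff, id]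
  constructor
  · rintro ⟨T, ⟨hTB, hT⟩, haT⟩
    exact ⟨π.le hT haT, fun haB => hTB (π.eq_of_mem_parts hT hB haT haB)⟩
  · rintro ⟨haA, haB⟩
    obtain ⟨T, hT, haT⟩ := π.exists_mem haA
    exact ⟨T, ⟨fun h => haB (h ▸ haT), hT⟩, haT⟩

section AddBlock

variable {x : ι} {S T : Finset ι}

lemma disjoint_insert_sdiff (hx : x ∉ S) : Disjoint (insert x T) (S \ T) := by
  simp only [Finset.disjoint_insert_left, mem_sdiff, hx, false_and, not_false_eq_true, true_and]
  exact Finset.disjoint_sdiff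

/-- The partition of `S ∪ {x}` obtained from one of `T ∪ {x}` by adding the block `S \ T`. Every
partition of `S ∪ {x}` with a distinguished block not containing `x` arises in this way. -/
def addBlock (hx : x ∉ S) (hT : T ⊂ S) (π : Finpartition (insert x T)) :
    Finpartition (insert x S) :=
  π.extend (sdiff_nonempty.mpr hT.2).ne_empty (disjoint_insert_sdiff hx) <| by
    rw [sup_eq_union, insert_union, union_sdiff_of_subset hT.1]

lemma parts_addBlock (hx : x ∉ S) (hT : T ⊂ S) (π : Finpartition (insert x T)) :
    (addBlock hx hT π).parts = insert (S \ T) π.parts := rfl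

lemma sdiff_notMem_parts (hx : x ∉ S) (hT : T ⊂ S) (π : Finpartition (insert x T)) :
    S \ T ∉ π.parts := fun h =>
  (sdiff_nonempty.mpr hT.2).ne_empty
    (disjoint_self.mp ((disjoint_insert_sdiff hx).mono_left (π.le h)))

lemma sum_ssubsets_sum_finpartition {M : Type*} [AddCommMonoid M] (hx : x ∉ S)
    (F : Finset (Finset ι) → Finset ι → M) :
    ∑ T ∈ S.ssubsets, ∑ π : Finpartition (insert x T), F π.parts (S \ T) =
      ∑ π : Finpartition (insert x S), ∑ B ∈ π.parts with x ∉ B, F (π.parts.erase B) B := by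
  have hss {p : Σ T, Finpartition (insert x T)} (hp : p ∈ S.ssubsets.sigma fun _ => univ) :
      p.1 ⊂ S := mem_ssubsets.mp (mem_sigma.mp hp).1
  rw [sum_sigma', sum_sigma']
  refine sum_bij (fun p hp => ⟨addBlock hx (hss hp) p.2, S \ p.1⟩) ?_ ?_ ?_ ?_
  · rintro ⟨T, π⟩ hp
    simp [parts_addBlock, hx]
  · rintro ⟨T₁, π₁⟩ h₁ ⟨T₂, π₂⟩ h₂ h
    simp only [Sigma.mk.injEq, heq_eq_eq] at h
    have hT₁ : T₁ ⊂ S := hss h₁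
    have hT₂ : T₂ ⊂ S := hss h₂
    obtain rfl : T₁ = T₂ := by
      rw [← Finset.sdiff_sdiff_eq_self hT₁.1, h.2, Finset.sdiff_sdiff_eq_self hT₂.1]
    have hparts := congrArg Finpartition.parts h.1
    rw [parts_addBlock, parts_addBlock] at hparts
    obtain rfl : π₁ = π₂ := Finpartition.ext <| by
      rw [← erase_insert (sdiff_notMem_parts hx hT₁ π₁), hparts,
        erase_insert (sdiff_notMem_parts hx hT₂ π₂)]
    rfl
  · rintro ⟨π, B⟩ hp
    simp only [mem_sigma, mem_univ, mem_filter, true_and] at hp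
    have hBS : B ⊆ S := (subset_insert_iff_of_notMem hp.2).mp (π.le hp.1)
    have hsub : S \ B ⊂ S := sdiff_ssubset hBS (π.nonempty_of_mem_parts hp.1)
    have hbase : (π.parts.erase B).sup id = insert x (S \ B) := by
      rw [sup_erase_parts π hp.1, insert_sdiff_of_notMem _ hp.2]
    have hBB : S \ (S \ B) = B := Finset.sdiff_sdiff_eq_self hBS
    refine ⟨⟨S \ B, π.ofSubset (erase_subset _ _) hbase⟩, by simpa using hsub, ?_⟩
    simp only [Sigma.mk.injEq, hBB, heq_eq_eq, and_true]
    refine Finpartition.ext ?_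
    simp [parts_addBlock, hBB, Finpartition.ofSubset, insert_erase hp.1]
  · rintro ⟨T, π⟩ hp
    have hT : T ⊂ S := hss hp
    rw [parts_addBlock, erase_insert (sdiff_notMem_parts hx hT π)]

end AddBlock

lemma card_filter_notMem_parts {A : Finset ι} {x : ι} (hx : x ∈ A) (π : Finpartition A) :
    #{B ∈ π.parts | x ∉ B} = #π.parts - 1 := by
  have h : {B ∈ π.parts | x ∈ B} = {π.part x} := by
    ext B
    simp only [mem_filter, mem_singleton]
    exact ⟨fun hB => (π.part_eq_of_mem hB.1 hB.2).symm,
      fun hB => hB ▸ ⟨π.part_mem.mpr hx, π.mem_part hx⟩⟩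
  have hcard := card_filter_add_card_filter_not (s := π.parts) (x ∈ ·)
  rw [h, card_singleton] at hcard
  omega

variable {R : Type*} [CommRing R]

/-- The Möbius function `(-1)^(k - 1) * (k - 1)!` of the partition lattice, the weight in a
cumulant of a partition into `k ≥ 1` blocks. -/
def cumulantCoeff (R : Type*) [CommRing R] (k : ℕ) : R := (-1) ^ (k - 1) * ((k - 1).factorial : R)

lemma cumulantCoeff_add_mul {k : ℕ} (hk : k ≠ 0) :
    cumulantCoeff R k + ((k - 1 : ℕ) : R) * cumulantCoeff R (k - 1) = if k = 1 then 1 else 0 := by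
  obtain _ | _ | k := k
  · exact absurd rfl hk
  · simp [cumulantCoeff]
  · simp only [cumulantCoeff, Nat.add_sub_cancel, Nat.factorial_succ, pow_succ]
    push_cast
    simp only [mul_neg, mul_one, neg_mul]
    ring

/-- The cumulants of a moment functional: `m B` stands for the joint moment of the variables
indexed by `B`. -/
def setCumulant (m : Finset ι → R) (S : Finset ι) : R :=
  ∑ π : Finpartition S, cumulantCoeff R #π.parts * ∏ B ∈ π.parts, m B

/-- Grouping the partitions by the block of `x` expresses moments through cumulants. -/
lemma moment_insert_eq_sum_setCumulant_mul {m : Finset ι → R} (hm : m ∅ = 1) {x : ι}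
    {S : Finset ι} (hx : x ∉ S) :
    m (insert x S) = ∑ T ∈ S.powerset, setCumulant m (insert x T) * m (S \ T) := by
  have hproper : ∑ T ∈ S.ssubsets, setCumulant m (insert x T) * m (S \ T) =
      ∑ π : Finpartition (insert x S), ((#π.parts - 1 : ℕ) : R) *
        cumulantCoeff R (#π.parts - 1) * ∏ B ∈ π.parts, m B := by
    simp only [setCumulant, sum_mul]
    rw [sum_ssubsets_sum_finpartition hx fun parts B =>
      cumulantCoeff R #parts * (∏ B' ∈ parts, m B') * m B]
    refine sum_congr rfl fun π _ => ?_
    rw [← card_filter_notMem_parts (mem_insert_self x S), mul_assoc, ← nsmul_eq_mul]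
    refine sum_eq_card_nsmul fun B hB => ?_
    rw [card_filter_notMem_parts (mem_insert_self x S),
      ← prod_erase_mul _ _ (mem_filter.mp hB).1, card_erase_of_mem (mem_filter.mp hB).1, mul_assoc]
  rw [← add_sum_erase _ _ (mem_powerset_self S), ← ssubsets, hproper, sdiff_self, bot_eq_empty, hm,
    mul_one, setCumulant, ← sum_add_distrib]
  simp only [← add_mul]
  rw [sum_eq_single (Finpartition.indiscrete (insert_ne_empty x S))]
  · simp [cumulantCoeff]
  · intro π _ hπ
    have hone : #π.parts ≠ 1 := fun h => hπ <| Finpartition.ext <| by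
      obtain ⟨B, hB⟩ := card_eq_one.mp h
      have hsup := π.sup_parts
      rw [hB, sup_singleton, id] at hsup
      rw [hB, hsup, Finpartition.indiscrete_parts]
    have hzero : #π.parts ≠ 0 :=
      card_ne_zero.mpr (π.parts_nonempty (insert_ne_empty x S))
    rw [cumulantCoeff_add_mul hzero, if_neg hone, zero_mul]
  · exact fun h => absurd (mem_univ _) h

lemma setCumulant_empty (m : Finset ι → R) : setCumulant m ∅ = cumulantCoeff R 0 := by
  have hparts (π : Finpartition (∅ : Finset ι)) : π.parts = ∅ := π.parts_eq_empty_iff.mpr rfl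
  have hcard : Fintype.card (Finpartition (∅ : Finset ι)) = 1 :=
    Fintype.card_eq_one_iff.mpr ⟨Finpartition.empty _, fun π => Finpartition.ext (hparts π)⟩
  simp [setCumulant, hparts, hcard]

lemma setCumulant_map {κ : Type*} [DecidableEq κ] {m : Finset ι → R} (hm : m ∅ = 1) (e : κ ↪ ι)
    (S : Finset κ) : setCumulant m (S.map e) = setCumulant (fun B => m (B.map e)) S := by
  induction S using Finset.strongInduction with
  | H S ih =>
    obtain rfl | ⟨x, hx⟩ := S.eq_empty_or_nonempty
    · simp only [map_empty, setCumulant_empty]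
    have hpow : ((S.erase x).map e).powerset =
        (S.erase x).powerset.map (mapEmbedding e).toEmbedding := by
      simp only [map_eq_image, powerset_image]
      exact image_congr fun T _ => (map_eq_image e T).symm
    have hdomain := moment_insert_eq_sum_setCumulant_mul (m := fun B => m (B.map e))
      (by simpa using hm) (notMem_erase x S)
    have hrange := moment_insert_eq_sum_setCumulant_mul hm
      (show e x ∉ (S.erase x).map e by simp)
    rw [hpow, sum_map, ← map_insert, hdomain] at hrange
    simp only [RelEmbedding.coe_toEmbedding, mapEmbedding_apply, ← map_insert, ← Finset.map_sdiff]
      at hrange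
    rw [← add_sum_erase _ _ (mem_powerset_self _), ← add_sum_erase _ _ (mem_powerset_self _),
      sdiff_self, bot_eq_empty, map_empty, hm, mul_one, mul_one, insert_erase hx] at hrange
    refine (add_right_cancel (hrange.trans ?_)).symm
    congr 1
    refine sum_congr rfl fun T hT => ?_
    have hTS : T ⊂ S.erase x := mem_ssubsets.mp hT
    have hxT : x ∉ T := fun h => notMem_erase x S (hTS.1 h)
    have hlt : insert x T ⊂ S := by
      rw [← insert_erase hx, ssubset_iff_subset_ne]
      exact ⟨insert_subset_insert x hTS.1, fun h => hTS.ne <| by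
        rw [← erase_insert hxT, h, erase_insert (notMem_erase x S)]⟩
    rw [ih _ hlt]

end Cumulants

section MultiIndices

open Finset

variable {ι : Type*} [Fintype ι]

/-- The product `α!` of the factorials of the entries of a multi-index. -/
def multiFactorial (α : ι → ℕ) : ℕ := ∏ j, (α j).factorial

/-- The product of the binomial coefficients of the entries of two multi-indices. -/
def multiBinom (α β : ι → ℕ) : ℕ := ∏ j, (α j).choose (β j)

lemma multiFactorial_ne_zero (α : ι → ℕ) : multiFactorial α ≠ 0 :=
  prod_ne_zero_iff.mpr fun j _ => (α j).factorial_ne_zero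

lemma multiBinom_self (α : ι → ℕ) : multiBinom α α = 1 := by simp [multiBinom]

lemma multiBinom_eq_zero {α β : ι → ℕ} (h : ¬ β ≤ α) : multiBinom α β = 0 := by
  obtain ⟨j, hj⟩ := not_forall.mp h
  exact prod_eq_zero (mem_univ j) (Nat.choose_eq_zero_of_lt (not_le.mp hj))

lemma prod_descFactorial (α β : ι → ℕ) :
    ∏ j, (α j).descFactorial (β j) = multiFactorial β * multiBinom α β := by
  simp only [Nat.descFactorial_eq_factorial_mul_choose, multiFactorial, multiBinom,
    prod_mul_distrib]

lemma multiBinom_mul_multiFactorial_mul {α β : ι → ℕ} (h : β ≤ α) :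
    multiBinom α β * multiFactorial β * multiFactorial (α - β) = multiFactorial α := by
  simp only [multiBinom, multiFactorial, ← prod_mul_distrib]
  exact prod_congr rfl fun j _ => Nat.choose_mul_factorial_mul_factorial (h j)

lemma sum_add_sum_sub {α β : ι → ℕ} (h : β ≤ α) : ∑ j, β j + ∑ j, (α - β) j = ∑ j, α j := by
  rw [← sum_add_distrib]
  exact sum_congr rfl fun j _ => Nat.add_sub_cancel' (h j)

variable [DecidableEq ι]

lemma sum_add_single (α : ι → ℕ) (i : ι) :
    ∑ j, (α + Pi.single i 1 : ι → ℕ) j = ∑ j, α j + 1 := by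
  simp [sum_add_distrib]

lemma prod_pow_add_single {R : Type*} [CommMonoid R] (x : ι → R) (α : ι → ℕ) (i : ι) :
    ∏ j, x j ^ (α + Pi.single i 1 : ι → ℕ) j = x i * ∏ j, x j ^ α j := by
  simp only [Pi.add_apply, pow_add, prod_mul_distrib, Pi.single_apply, pow_ite, pow_one, pow_zero,
    prod_ite_eq', mem_univ, if_true, mul_comm]

lemma sum_multiBinom (α : ι → ℕ) : ∑ β ∈ Iic α, multiBinom α β = 2 ^ ∑ j, α j := by
  have hIic : Iic α = Fintype.piFinset fun j => range (α j + 1) := by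
    ext β
    simp [Pi.le_def]
  simp only [hIic, multiBinom, ← prod_univ_sum, Nat.sum_range_choose, prod_pow_eq_pow_sum]

lemma mem_piAntidiag_univ {k : ℕ} {β : ι → ℕ} : β ∈ piAntidiag univ k ↔ ∑ j, β j = k := by
  simp [mem_piAntidiag]

/-- The multi-indices of order at most `d`. -/
def multiIndicesLE (ι : Type*) [Fintype ι] [DecidableEq ι] (d : ℕ) : Finset (ι → ℕ) :=
  (range (d + 1)).biUnion (piAntidiag univ)

lemma mem_multiIndicesLE {d : ℕ} {β : ι → ℕ} : β ∈ multiIndicesLE ι d ↔ ∑ j, β j ≤ d := by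
  simp [multiIndicesLE]

lemma sum_multiIndicesLE {M : Type*} [AddCommMonoid M] (d : ℕ) (F : (ι → ℕ) → M) :
    ∑ β ∈ multiIndicesLE ι d, F β = ∑ k ∈ range (d + 1), ∑ β ∈ piAntidiag univ k, F β :=
  sum_biUnion fun _ _ _ _ hkm => disjoint_left.mpr fun _ hk hm =>
    hkm ((mem_piAntidiag_univ.mp hk).symm.trans (mem_piAntidiag_univ.mp hm))

lemma sum_piAntidiag_sum_Iio {R : Type*} [CommSemiring R] (d : ℕ) (F G : (ι → ℕ) → R) :
    ∑ α ∈ piAntidiag univ d, ∑ β ∈ Iio α, F β * G (α - β) =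
      ∑ k ∈ range d, (∑ β ∈ piAntidiag univ k, F β) * ∑ γ ∈ piAntidiag univ (d - k), G γ := by
  simp only [sum_mul_sum, ← sum_product']
  rw [sum_sigma', sum_sigma']
  refine sum_bij' (fun p _ => ⟨∑ j, p.2 j, (p.2, p.1 - p.2)⟩) (fun p _ => ⟨p.2.1 + p.2.2, p.2.1⟩)
    ?_ ?_ ?_ ?_ fun _ _ => rfl
  · rintro ⟨α, β⟩ h
    simp only [mem_sigma, mem_piAntidiag_univ, mem_Iio, mem_range, mem_product, true_and] at h ⊢
    have hsum := sum_add_sum_sub h.2.le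
    have hlt : ∑ j, β j < ∑ j, α j := Fintype.sum_strictMono h.2
    omega
  · rintro ⟨k, β, γ⟩ h
    simp only [mem_sigma, mem_piAntidiag_univ, mem_Iio, mem_range, mem_product, Pi.add_apply,
      sum_add_distrib] at h ⊢
    refine ⟨by omega, lt_add_of_pos_right β (pos_iff_ne_zero.mpr ?_)⟩
    rintro rfl
    simp only [Pi.zero_apply, sum_const_zero] at h
    omega
  · rintro ⟨α, β⟩ h
    simp only [mem_sigma, mem_Iio] at h
    simp only [add_tsub_cancel_of_le h.2.le]
  · rintro ⟨k, β, γ⟩ h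
    simp only [mem_sigma, mem_piAntidiag_univ, mem_product] at h
    simp only [add_tsub_cancel_left, h.2.1]

end MultiIndices

section Labels

open Finset

variable {ι κ : Type*} [DecidableEq κ]

/-- The multi-index of the multiset of labels of `T`: its `j`-th entry counts the elements of `T`
with label `j`. -/
def labelCount (l : ι → κ) (T : Finset ι) (j : κ) : ℕ := #{s ∈ T | l s = j}

lemma labelCount_mono (l : ι → κ) {S T : Finset ι} (h : S ⊆ T) : labelCount l S ≤ labelCount l T :=
  fun _ => card_le_card (filter_subset_filter _ h)

lemma prod_label_eq [Fintype κ] {R : Type*} [CommMonoid R] (l : ι → κ) (T : Finset ι) (x : κ → R) :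
    ∏ s ∈ T, x (l s) = ∏ j, x j ^ labelCount l T j := by
  simp only [← prod_fiberwise' T l x, prod_const, labelCount]

lemma labelCount_insert [DecidableEq ι] (l : ι → κ) {T : Finset ι} {x : ι} (hx : x ∉ T) :
    labelCount l (insert x T) = labelCount l T + Pi.single (l x) 1 := by
  ext j
  by_cases hj : l x = j
  · subst hj
    simp [labelCount, filter_insert, hx]
  · simp [labelCount, filter_insert, hj, Ne.symm hj]

lemma labelCount_sdiff [DecidableEq ι] (l : ι → κ) {S T : Finset ι} (h : T ⊆ S) :
    labelCount l (S \ T) = labelCount l S - labelCount l T := by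
  ext j
  rw [Pi.sub_apply, labelCount, labelCount, labelCount, ← card_sdiff_of_subset
    (filter_subset_filter _ h)]
  congr 1
  ext s
  simp only [mem_filter, mem_sdiff]
  tauto

variable [Fintype κ]

lemma card_filter_labelCount_eq (l : ι → κ) (S : Finset ι) (β : κ → ℕ) :
    #{T ∈ S.powerset | labelCount l T = β} = multiBinom (labelCount l S) β := by
  classical
  have hfiber {g : κ → Finset ι} (hg : ∀ j, g j ⊆ {s ∈ S | l s = j}) (j : κ) :
      {s ∈ univ.biUnion g | l s = j} = g j := by
    ext s
    simp only [mem_filter, mem_biUnion, mem_univ, true_and]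
    constructor
    · rintro ⟨⟨j', hs⟩, rfl⟩
      rwa [(mem_filter.mp (hg j' hs)).2]
    · exact fun hs => ⟨⟨j, hs⟩, (mem_filter.mp (hg j hs)).2⟩
  simp only [multiBinom, labelCount, ← card_powersetCard, ← Fintype.card_piFinset]
  refine card_bij' (fun T _ j => {s ∈ T | l s = j}) (fun g _ => univ.biUnion g) ?_ ?_ ?_ ?_
  · intro T hT
    obtain ⟨hTS, rfl⟩ := mem_filter.mp hT
    exact Fintype.mem_piFinset.mpr fun j =>
      mem_powersetCard.mpr ⟨filter_subset_filter _ (mem_powerset.mp hTS), rfl⟩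
  · intro g hg
    have hg' (j : κ) := mem_powersetCard.mp (Fintype.mem_piFinset.mp hg j)
    refine mem_filter.mpr ⟨mem_powerset.mpr (biUnion_subset.mpr fun j _ =>
      (hg' j).1.trans (filter_subset _ _)), funext fun j => ?_⟩
    rw [labelCount, hfiber fun j => (hg' j).1, (hg' j).2]
  · exact fun T _ => biUnion_filter_eq_of_maps_to fun s _ => mem_univ (l s)
  · exact fun g hg => funext <| hfiber fun j =>
      (mem_powersetCard.mp (Fintype.mem_piFinset.mp hg j)).1

lemma sum_powerset_labelCount {R : Type*} [CommSemiring R] (l : ι → κ) (S : Finset ι)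
    (F : (κ → ℕ) → R) :
    ∑ T ∈ S.powerset, F (labelCount l T) =
      ∑ β ∈ Iic (labelCount l S), (multiBinom (labelCount l S) β : R) * F β := by
  have hle : ∀ T ∈ S.powerset, labelCount l T ∈ Iic (labelCount l S) := fun T hT =>
    mem_Iic.mpr (labelCount_mono l (mem_powerset.mp hT))
  rw [← sum_fiberwise_of_maps_to hle]
  refine sum_congr rfl fun β _ => ?_
  rw [sum_eq_card_nsmul fun T hT => by rw [(mem_filter.mp hT).2], card_filter_labelCount_eq,
    nsmul_eq_mul]

end Labels

section MomentCumulant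

open Finset

/-- The moment `𝔼 ∏ X_j ^ α_j`. -/
noncomputable def multiMoment {n : ℕ} (P : Measure (Fin n → ℝ)) (α : Fin n → ℕ) : ℝ :=
  ∫ x, ∏ j, x j ^ α j ∂P

variable {n : ℕ} (P : Measure (Fin n → ℝ))

lemma exists_embedding_of_labelCount {ι κ : Type*} [DecidableEq κ] [Fintype κ] (l : ι → κ)
    (T : Finset ι) :
    ∃ e : (Σ j, Fin (labelCount l T j)) ↪ ι, univ.map e = T ∧ ∀ p, l (e p) = p.1 := by
  let e : (Σ j, Fin (labelCount l T j)) → ι := fun p => (equivFin {s ∈ T | l s = p.1}).symm p.2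
  have he (p) : e p ∈ T ∧ l (e p) = p.1 :=
    mem_filter.mp ((equivFin {s ∈ T | l s = p.1}).symm p.2).2
  have hinj : Function.Injective e := by
    rintro ⟨j, a⟩ ⟨j', a'⟩ h
    obtain rfl : j = j' := (he ⟨j, a⟩).2.symm.trans ((congrArg l h).trans (he ⟨j', a'⟩).2)
    exact congrArg _ ((equivFin {s ∈ T | l s = j}).symm.injective (Subtype.ext h))
  refine ⟨⟨e, hinj⟩, ?_, fun p => (he p).2⟩
  ext s
  simp only [mem_map, mem_univ, true_and, Function.Embedding.coeFn_mk]
  refine ⟨fun ⟨p, hp⟩ => hp ▸ (he p).1, fun hs => ?_⟩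
  exact ⟨⟨l s, equivFin {t ∈ T | l t = l s} ⟨s, mem_filter.mpr ⟨hs, rfl⟩⟩⟩, by simp [e]⟩

variable [IsProbabilityMeasure P]

lemma multiMoment_labelCount_empty {ι : Type*} (l : ι → Fin n) :
    multiMoment P (labelCount l ∅) = 1 := by
  simp [multiMoment, labelCount]

lemma setCumulant_label {ι : Type*} [DecidableEq ι] (l : ι → Fin n) (T : Finset ι) :
    setCumulant (fun B => multiMoment P (labelCount l B)) T = cumulant P (labelCount l T) := by
  obtain ⟨e, hmap, he⟩ := exists_embedding_of_labelCount l T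
  conv_lhs => rw [← hmap]
  rw [setCumulant_map (multiMoment_labelCount_empty P l)]
  simp only [multiMoment, ← prod_label_eq, prod_map, he]
  rfl

lemma multiMoment_add_single (i : Fin n) (α : Fin n → ℕ) :
    multiMoment P (α + Pi.single i 1) = ∑ β ∈ Iic α, (multiBinom α β : ℝ) *
      (cumulant P (β + Pi.single i 1) * multiMoment P (α - β)) := by
  -- `α j` objects labelled `j` for each `j`, and one further object `x` labelled `i`
  let S : Finset (Σ _ : Fin n, ℕ) := univ.sigma fun j => range (α j)
  let x : Σ _ : Fin n, ℕ := ⟨i, α i⟩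
  have hx : x ∉ S := by simp [S, x]
  have hS : labelCount Sigma.fst S = α := funext fun j => by
    have hfiber : {s ∈ S | s.1 = j} = (range (α j)).map (Function.Embedding.sigmaMk j) := by
      ext ⟨j', a⟩
      simp only [S, mem_filter, mem_sigma, mem_univ, true_and, mem_map,
        Function.Embedding.sigmaMk_apply]
      grind
    rw [labelCount, hfiber, card_map, card_range]
  have hrec := moment_insert_eq_sum_setCumulant_mul
    (m := fun B => multiMoment P (labelCount Sigma.fst B))
    (multiMoment_labelCount_empty P Sigma.fst) hx
  simp only [setCumulant_label] at hrec
  have hsum := sum_powerset_labelCount Sigma.fst S fun β =>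
    cumulant P (β + Pi.single i 1) * multiMoment P (α - β)
  rw [hS] at hsum
  rw [labelCount_insert _ hx, hS] at hrec
  rw [hrec, ← hsum]
  refine sum_congr rfl fun T hT => ?_
  have hTS := mem_powerset.mp hT
  rw [labelCount_insert _ fun h => hx (hTS h), labelCount_sdiff _ hTS, hS]

end MomentCumulant

section Certificate

variable {n : ℕ}

/-- The multivariate Hermite polynomial of multi-index `α`. -/
noncomputable def hermiteProd (α : Fin n → ℕ) (z : Fin n → ℝ) : ℝ :=
  ∏ j, (hermiteReal (α j)).eval (z j)

lemma hermiteProd_zero (z : Fin n → ℝ) : hermiteProd 0 z = 1 := by simp [hermiteProd]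

lemma integral_hermiteProd_mul (α β : Fin n → ℕ) (t : Fin n → ℝ) :
    ∫ z, hermiteProd β z * hermiteProd α (fun j => t j + z j)
        ∂(Measure.pi fun _ : Fin n => gaussianReal 0 1) =
      multiFactorial β * multiBinom α β * ∏ j, t j ^ (α j - β j) := by
  simp only [hermiteProd, ← Finset.prod_mul_distrib]
  rw [integral_fintype_prod_eq_prod (fun j (x : ℝ) =>
    (hermiteReal (β j)).eval x * (hermiteReal (α j)).eval (t j + x)), ← Nat.cast_mul,
    ← prod_descFactorial, Nat.cast_prod, ← Finset.prod_mul_distrib]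
  exact Finset.prod_congr rfl fun j _ => integral_hermiteReal_mul_hermiteReal_comp _ _ _

lemma HasAllMoments.signal {P : Measure (Fin n → ℝ)} {a : (Fin n → ℝ) → ℝ}
    (ha : HasAllMoments a P) : HasAllMoments (fun ω => a ω.1) (signalNoiseLaw P) :=
  ha.comp measurePreserving_fst

/-- The coefficients, in the Hermite basis, of the dual certificate for the coordinate `i`. -/
noncomputable def certificateCoeff (P : Measure (Fin n → ℝ)) (lam : ℝ) (i : Fin n)
    (β : Fin n → ℕ) : ℝ :=
  √lam ^ (∑ j, β j) * cumulant P (β + Pi.single i 1) / multiFactorial β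

lemma certificateCoeff_mul (P : Measure (Fin n → ℝ)) (lam : ℝ) (i : Fin n) {α β : Fin n → ℕ}
    (hβ : β ≤ α) (x y : ℝ) :
    certificateCoeff P lam i β * (multiFactorial β * x * (√lam ^ (∑ j, (α - β) j) * y)) =
      √lam ^ (∑ j, α j) * (x * (cumulant P (β + Pi.single i 1) * y)) := by
  have hfact : (multiFactorial β : ℝ) ≠ 0 := Nat.cast_ne_zero.mpr (multiFactorial_ne_zero β)
  rw [certificateCoeff, ← sum_add_sum_sub hβ, pow_add]
  field_simp

variable {P : Measure (Fin n → ℝ)} [IsProbabilityMeasure P]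

instance : IsProbabilityMeasure (signalNoiseLaw P) := by
  unfold signalNoiseLaw; infer_instance

lemma hasAllMoments_noise (j : Fin n) :
    HasAllMoments (fun ω => ω.2 j) (signalNoiseLaw P) := by
  have h1 : MeasurePreserving (fun ω : (Fin n → ℝ) × (Fin n → ℝ) => ω.2) (signalNoiseLaw P)
    (Measure.pi fun _ => gaussianReal 0 1) := measurePreserving_snd
  exact hasAllMoments_gaussianReal.comp
    ((measurePreserving_eval (fun _ : Fin n => gaussianReal 0 1) j).comp h1)

lemma hasAllMoments_observation (hP : ∀ j, HasAllMoments (fun x => x j) P) (lam : ℝ)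
    (j : Fin n) : HasAllMoments (fun ω => observation lam ω j) (signalNoiseLaw P) :=
  ((hP j).signal.const_mul _).add (hasAllMoments_noise j)

lemma hasAllMoments_hermiteProd {Ω : Type*} [MeasurableSpace Ω] {μ : Measure Ω}
    [IsFiniteMeasure μ] {Y : Ω → Fin n → ℝ} (hY : ∀ j, HasAllMoments (fun ω => Y ω j) μ)
    (α : Fin n → ℕ) : HasAllMoments (fun ω => hermiteProd α (Y ω)) μ :=
  HasAllMoments.prod fun j _ => (hY j).polynomial _

lemma integral_mul_hermiteProd_mul (hP : ∀ j, HasAllMoments (fun x => x j) P) (lam : ℝ)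
    {a : (Fin n → ℝ) → ℝ} (ha : HasAllMoments a P) (α β : Fin n → ℕ) :
    ∫ ω, a ω.1 * (hermiteProd β ω.2 * hermiteProd α (observation lam ω)) ∂signalNoiseLaw P =
      multiFactorial β * multiBinom α β * (√lam ^ (∑ j, (α - β) j) *
        ∫ x, a x * ∏ j, x j ^ (α - β) j ∂P) := by
  have hint := (ha.signal.mul ((hasAllMoments_hermiteProd hasAllMoments_noise β).mul
    (hasAllMoments_hermiteProd (hasAllMoments_observation hP lam) α))).integrable
  rw [signalNoiseLaw] at hint ⊢
  rw [integral_prod _ hint, ← integral_const_mul, ← integral_const_mul]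
  congr 1 with x
  have hobs (z : Fin n → ℝ) : observation lam (x, z) = fun j => √lam * x j + z j := rfl
  simp only [integral_const_mul, hobs, integral_hermiteProd_mul, mul_pow, Finset.prod_mul_distrib,
    Finset.prod_pow_eq_pow_sum, Pi.sub_apply]
  ring

lemma integral_hermiteProd_mul_hermiteProd (hP : ∀ j, HasAllMoments (fun x => x j) P)
    (α β : Fin n → ℕ) :
    ∫ ω, hermiteProd β ω.2 * hermiteProd α ω.2 ∂signalNoiseLaw P =
      if α = β then (multiFactorial β : ℝ) else 0 := by
  have h := integral_mul_hermiteProd_mul hP 0 (HasAllMoments.const 1) α β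
  have hobs (ω : (Fin n → ℝ) × (Fin n → ℝ)) : observation 0 ω = ω.2 := by
    ext j; simp [observation]
  simp only [hobs, one_mul, Real.sqrt_zero] at h
  rw [h]
  split_ifs with hαβ
  · simp [hαβ, multiBinom_self]
  · by_cases hle : β ≤ α
    · have hlt : ∑ j, β j < ∑ j, α j := Fintype.sum_strictMono (lt_of_le_of_ne' hle hαβ)
      have hsum := sum_add_sum_sub hle
      rw [zero_pow (by omega), zero_mul, mul_zero]
    · rw [multiBinom_eq_zero hle, Nat.cast_zero, mul_zero, zero_mul]

/-- A function of the noise with the same correlations as `X_i` with polynomials of degree at most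
`d` in the observation. -/
noncomputable def certificate (P : Measure (Fin n → ℝ)) (lam : ℝ) (i : Fin n) (d : ℕ)
    (z : Fin n → ℝ) : ℝ :=
  ∑ β ∈ multiIndicesLE (Fin n) d, certificateCoeff P lam i β * hermiteProd β z

lemma hasAllMoments_certificate (lam : ℝ) (i : Fin n) (d : ℕ) :
    HasAllMoments (fun ω => certificate P lam i d ω.2) (signalNoiseLaw P) :=
  HasAllMoments.sum fun β _ => (hasAllMoments_hermiteProd hasAllMoments_noise β).const_mul _

lemma integral_certificate_sq (hP : ∀ j, HasAllMoments (fun x => x j) P) {lam : ℝ}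
    (hlam : 0 ≤ lam) (i : Fin n) (d : ℕ) :
    ∫ ω, certificate P lam i d ω.2 ^ 2 ∂signalNoiseLaw P =
      ∑ β ∈ multiIndicesLE (Fin n) d,
        lam ^ (∑ j, β j) * cumulant P (β + Pi.single i 1) ^ 2 / multiFactorial β := by
  have hint (α β : Fin n → ℕ) := ((hasAllMoments_hermiteProd (hasAllMoments_noise (P := P)) β).mul
    (hasAllMoments_hermiteProd hasAllMoments_noise α)).const_mul
      (certificateCoeff P lam i β * certificateCoeff P lam i α)
  have e : (fun ω : (Fin n → ℝ) × (Fin n → ℝ) => certificate P lam i d ω.2 ^ 2) =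
      fun ω => ∑ β ∈ multiIndicesLE (Fin n) d, ∑ α ∈ multiIndicesLE (Fin n) d,
        certificateCoeff P lam i β * certificateCoeff P lam i α *
          (hermiteProd β ω.2 * hermiteProd α ω.2) := by
    ext ω
    rw [sq, certificate, Finset.sum_mul_sum]
    refine Finset.sum_congr rfl fun β _ => Finset.sum_congr rfl fun α _ => by ring
  rw [e, integral_finsetSum _ fun β _ => (HasAllMoments.sum fun α _ => hint α β).integrable]
  refine Finset.sum_congr rfl fun β hβ => ?_
  rw [integral_finsetSum _ fun α _ => (hint α β).integrable]
  simp only [integral_const_mul, integral_hermiteProd_mul_hermiteProd hP, mul_ite, mul_zero]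
  rw [Finset.sum_ite_eq', if_pos hβ, certificateCoeff]
  have h1 := Nat.cast_ne_zero (R := ℝ).mpr (multiFactorial_ne_zero β)
  have h2 : (√lam ^ (∑ j, β j)) ^ 2 = lam ^ (∑ j, β j) := by
    rw [← pow_mul, mul_comm, pow_mul, Real.sq_sqrt hlam]
  rw [← h2]
  field_simp

lemma integral_signal_mul_hermiteProd (hP : ∀ j, HasAllMoments (fun x => x j) P) (lam : ℝ)
    (i : Fin n) (α : Fin n → ℕ) :
    ∫ ω, ω.1 i * hermiteProd α (observation lam ω) ∂signalNoiseLaw P =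
      √lam ^ (∑ j, α j) * multiMoment P (α + Pi.single i 1) := by
  have h := integral_mul_hermiteProd_mul hP lam (hP i) α 0
  simp only [hermiteProd_zero, one_mul, tsub_zero, multiFactorial, multiBinom, Pi.zero_apply,
    Nat.factorial_zero, Nat.choose_zero_right, Finset.prod_const_one, Nat.cast_one] at h
  simp only [h, multiMoment, prod_pow_add_single]

/-- The moment-cumulant recursion is what makes the cumulants the coefficients of a certificate. -/
lemma integral_certificate_mul_hermiteProd (hP : ∀ j, HasAllMoments (fun x => x j) P)
    (lam : ℝ) (i : Fin n) {d : ℕ} {α : Fin n → ℕ} (hα : ∑ j, α j ≤ d) :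
    ∫ ω, certificate P lam i d ω.2 * hermiteProd α (observation lam ω) ∂signalNoiseLaw P =
      ∫ ω, ω.1 i * hermiteProd α (observation lam ω) ∂signalNoiseLaw P := by
  have hint (β : Fin n → ℕ) := (((hasAllMoments_hermiteProd (hasAllMoments_noise (P := P)) β).mul
    (hasAllMoments_hermiteProd (hasAllMoments_observation hP lam) α)).const_mul
      (certificateCoeff P lam i β)).integrable
  have hterm (β : Fin n → ℕ) : ∫ ω, certificateCoeff P lam i β *
      (hermiteProd β ω.2 * hermiteProd α (observation lam ω)) ∂signalNoiseLaw P =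
      certificateCoeff P lam i β * (multiFactorial β * multiBinom α β *
        (√lam ^ (∑ j, (α - β) j) * multiMoment P (α - β))) := by
    have h := integral_mul_hermiteProd_mul hP lam (HasAllMoments.const 1) α β
    simp only [one_mul] at h
    rw [integral_const_mul, h, multiMoment]
  have hsub : Finset.Iic α ⊆ multiIndicesLE (Fin n) d := fun β hβ =>
    mem_multiIndicesLE.mpr ((Fintype.sum_mono (Finset.mem_Iic.mp hβ)).trans hα)
  simp only [certificate, Finset.sum_mul, mul_assoc]
  rw [integral_finsetSum _ fun β _ => hint β, integral_signal_mul_hermiteProd hP,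
    multiMoment_add_single, Finset.mul_sum]
  simp only [hterm]
  rw [← Finset.sum_subset hsub]
  · exact Finset.sum_congr rfl fun β hβ => certificateCoeff_mul P lam i (Finset.mem_Iic.mp hβ) _ _
  · intro β _ hβ
    rw [multiBinom_eq_zero fun h => hβ (Finset.mem_Iic.mpr h), Nat.cast_zero, mul_zero, zero_mul,
      mul_zero]

lemma eval_mem_span_hermiteProd {d : ℕ} {g : MvPolynomial (Fin n) ℝ} (hg : g.totalDegree ≤ d) :
    (fun y => MvPolynomial.eval y g) ∈
      Submodule.span ℝ (hermiteProd '' {α : Fin n → ℕ | ∑ j, α j ≤ d}) := by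
  choose c hc using fun k => exists_eq_sum_hermiteReal (Polynomial.natDegree_X_pow_le (R := ℝ) k)
  have hpow (x : ℝ) (k : ℕ) :
      x ^ k = ∑ a ∈ Finset.range (k + 1), c k a * (hermiteReal a).eval x := by
    simpa [Polynomial.eval_finsetSum] using congrArg (Polynomial.eval x) (hc k)
  have hexpand : (fun y => MvPolynomial.eval y g) =
      ∑ s ∈ g.support, g.coeff s • ∑ p ∈ Fintype.piFinset fun j => Finset.range (s j + 1),
        (∏ j, c (s j) (p j)) • hermiteProd p := by
    ext y
    simp only [MvPolynomial.eval_eq', Finset.sum_apply, Pi.smul_apply, smul_eq_mul, hpow,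
      Finset.prod_univ_sum, hermiteProd, Finset.prod_mul_distrib]
  rw [hexpand]
  refine Submodule.sum_mem _ fun s hs => Submodule.smul_mem _ _ <|
    Submodule.sum_mem _ fun p hp => Submodule.smul_mem _ _ <| Submodule.subset_span ⟨p, ?_, rfl⟩
  calc ∑ j, p j ≤ ∑ j, s j := Finset.sum_le_sum fun j _ =>
        Finset.mem_range_succ_iff.mp (Fintype.mem_piFinset.mp hp j)
    _ = s.sum fun _ e => e := (Finsupp.sum_fintype s (fun _ e => e) fun _ => rfl).symm
    _ ≤ d := (MvPolynomial.le_totalDegree hs).trans hg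

lemma integral_certificate_mul_eval (hP : ∀ j, HasAllMoments (fun x => x j) P)
    (lam : ℝ) (i : Fin n) {d : ℕ} {g : MvPolynomial (Fin n) ℝ} (hg : g.totalDegree ≤ d) :
    ∫ ω, certificate P lam i d ω.2 * MvPolynomial.eval (observation lam ω) g ∂signalNoiseLaw P =
      ∫ ω, ω.1 i * MvPolynomial.eval (observation lam ω) g ∂signalNoiseLaw P := by
  have hW := hasAllMoments_certificate (P := P) lam i d
  have hX := (hP i).signal
  have key : ∀ h ∈ Submodule.span ℝ (hermiteProd '' {α : Fin n → ℕ | ∑ j, α j ≤ d}),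
      HasAllMoments (fun ω => h (observation lam ω)) (signalNoiseLaw P) ∧
      ∫ ω, certificate P lam i d ω.2 * h (observation lam ω) ∂signalNoiseLaw P =
        ∫ ω, ω.1 i * h (observation lam ω) ∂signalNoiseLaw P := by
    intro h hh
    induction hh using Submodule.span_induction with
    | mem h hh =>
      obtain ⟨α, hα, rfl⟩ := hh
      exact ⟨hasAllMoments_hermiteProd (hasAllMoments_observation hP lam) α,
        integral_certificate_mul_hermiteProd hP lam i hα⟩
    | zero => exact ⟨HasAllMoments.const 0, by simp⟩
    | add h k _ _ ih ik =>
      refine ⟨ih.1.add ik.1, ?_⟩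
      simp only [Pi.add_apply, mul_add]
      rw [integral_add (hW.mul ih.1).integrable (hW.mul ik.1).integrable,
        integral_add (hX.mul ih.1).integrable (hX.mul ik.1).integrable, ih.2, ik.2]
    | smul a h _ ih =>
      refine ⟨ih.1.const_mul a, ?_⟩
      simp only [Pi.smul_apply, smul_eq_mul, mul_left_comm _ a]
      rw [integral_const_mul, integral_const_mul, ih.2]
  exact (key _ (eval_mem_span_hermiteProd hg)).2

lemma lowDegreeCorr_sq_le (hP : ∀ j, HasAllMoments (fun x => x j) P) {lam : ℝ}
    (hlam : 0 ≤ lam) (d : ℕ) :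
    lowDegreeCorr P d lam ^ 2 ≤ ∑ i : Fin n, ∑ β ∈ multiIndicesLE (Fin n) d,
      lam ^ (∑ j, β j) * cumulant P (β + Pi.single i 1) ^ 2 / multiFactorial β := by
  rw [lowDegreeCorr, Real.sq_sqrt]
  · refine Finset.sum_le_sum fun i _ => Real.sSup_le ?_ ?_
    · rintro _ ⟨g, hg, hg1, rfl⟩
      have h := sq_integral_mul_le
        (by simpa using hasAllMoments_certificate (P := P) lam i d 2)
        (by simpa using HasAllMoments.mvPolynomial (hasAllMoments_observation hP lam) g 2)
      rw [integral_certificate_mul_eval hP lam i hg, hg1, mul_one,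
        integral_certificate_sq hP hlam] at h
      simpa only [mul_comm] using h
    · exact Finset.sum_nonneg fun β _ => by positivity
  · refine Finset.sum_nonneg fun i _ => Real.sSup_nonneg ?_
    rintro _ ⟨g, -, -, rfl⟩
    positivity

end Certificate

section Overlap

open Finset

variable {n : ℕ}

/-- The overlap `⟨x, x'⟩` of a pair of signals. -/
def overlap (x : (Fin n → ℝ) × (Fin n → ℝ)) : ℝ := ∑ i, x.1 i * x.2 i

/-- The `k`-th moment of the overlap of two independent signals. -/
noncomputable def overlapMoment (P : Measure (Fin n → ℝ)) (k : ℕ) : ℝ :=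
  ∫ x, overlap x ^ k ∂P.prod P

lemma multinomial_eq_div_multiFactorial {k : ℕ} {β : Fin n → ℕ}
    (hβ : β ∈ piAntidiag univ k) :
    (Nat.multinomial univ β : ℝ) = k.factorial / multiFactorial β := by
  have h := Nat.multinomial_spec univ β
  rw [mem_piAntidiag_univ.mp hβ] at h
  rw [eq_div_iff (Nat.cast_ne_zero.mpr (multiFactorial_ne_zero β)), mul_comm, ← h, multiFactorial,
    Nat.cast_mul]

variable {P : Measure (Fin n → ℝ)} [IsProbabilityMeasure P]

lemma hasAllMoments_overlap (hP : ∀ j, HasAllMoments (fun x => x j) P) :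
    HasAllMoments (overlap (n := n)) (P.prod P) :=
  HasAllMoments.sum fun i _ => ((hP i).comp measurePreserving_fst).mul
    ((hP i).comp measurePreserving_snd)

/-- Independence of the two signals turns moments of the overlap into sums of squares. -/
lemma integral_mul_mul_overlap_pow (hP : ∀ j, HasAllMoments (fun x => x j) P)
    {a : (Fin n → ℝ) → ℝ} (ha : HasAllMoments a P) (k : ℕ) :
    ∫ x, a x.1 * a x.2 * overlap x ^ k ∂P.prod P =
      k.factorial * ∑ β ∈ piAntidiag univ k,
        (∫ x, a x * ∏ j, x j ^ β j ∂P) ^ 2 / multiFactorial β := by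
  have hmon (β : Fin n → ℕ) : HasAllMoments (fun x => a x * ∏ j, x j ^ β j) P :=
    ha.mul (HasAllMoments.prod fun j _ => (hP j).pow _)
  have hexpand : (fun x : (Fin n → ℝ) × (Fin n → ℝ) => a x.1 * a x.2 * overlap x ^ k) =
      fun x => ∑ β ∈ piAntidiag univ k, (Nat.multinomial univ β : ℝ) *
        ((a x.1 * ∏ j, x.1 j ^ β j) * (a x.2 * ∏ j, x.2 j ^ β j)) := by
    ext x
    rw [overlap, sum_pow_eq_sum_piAntidiag, mul_sum]
    refine sum_congr rfl fun β _ => ?_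
    simp only [mul_pow, prod_mul_distrib]
    ring
  rw [hexpand, integral_finsetSum, mul_sum]
  · refine sum_congr rfl fun β hβ => ?_
    rw [integral_const_mul, integral_prod_mul (fun x => a x * ∏ j, x j ^ β j)
      (fun x => a x * ∏ j, x j ^ β j), multinomial_eq_div_multiFactorial hβ]
    ring
  · exact fun β _ => (((hmon β).comp measurePreserving_fst).mul
      ((hmon β).comp measurePreserving_snd)).const_mul _ |>.integrable

lemma sum_multiMoment_sq (hP : ∀ j, HasAllMoments (fun x => x j) P) (k : ℕ) :
    ∑ β ∈ piAntidiag univ k, multiMoment P β ^ 2 / multiFactorial β =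
      overlapMoment P k / k.factorial := by
  have h := integral_mul_mul_overlap_pow hP (HasAllMoments.const 1) k
  simp only [one_mul] at h
  rw [overlapMoment, h, mul_div_cancel_left₀ _ (Nat.cast_ne_zero.mpr k.factorial_ne_zero)]
  rfl

lemma sum_sum_multiMoment_add_single_sq (hP : ∀ j, HasAllMoments (fun x => x j) P) (k : ℕ) :
    ∑ i, ∑ β ∈ piAntidiag univ k, multiMoment P (β + Pi.single i 1) ^ 2 / multiFactorial β =
      overlapMoment P (k + 1) / k.factorial := by
  have hk : (k.factorial : ℝ) ≠ 0 := Nat.cast_ne_zero.mpr k.factorial_ne_zero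
  have hexpand : (fun x : (Fin n → ℝ) × (Fin n → ℝ) => overlap x ^ (k + 1)) =
      fun x => ∑ i, x.1 i * x.2 i * overlap x ^ k := by
    ext x
    rw [← sum_mul, pow_succ']
    rfl
  rw [overlapMoment, hexpand, integral_finsetSum, sum_div]
  · refine sum_congr rfl fun i _ => ?_
    rw [integral_mul_mul_overlap_pow hP (hP i), mul_div_cancel_left₀ _ hk]
    simp only [multiMoment, prod_pow_add_single]
  · exact fun i _ => ((((hP i).comp measurePreserving_fst).mul
      ((hP i).comp measurePreserving_snd)).mul ((hasAllMoments_overlap hP).pow k)).integrable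

end Overlap

section NonnegativeCumulants

open Finset

variable {n d : ℕ} {P : Measure (Fin n → ℝ)}

lemma cumulant_add_single_nonneg
    (hκ : ∀ α : Fin n → ℕ, 1 ≤ ∑ i, α i → ∑ i, α i ≤ d → 0 ≤ cumulant P α)
    (i : Fin n) {β : Fin n → ℕ} (hβ : ∑ j, β j < d) : 0 ≤ cumulant P (β + Pi.single i 1) :=
  hκ _ (by rw [sum_add_single]; omega) (by rw [sum_add_single]; omega)

variable [IsProbabilityMeasure P]

lemma multiMoment_zero : multiMoment P 0 = 1 := by simp [multiMoment]

lemma multiMoment_nonneg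
    (hκ : ∀ α : Fin n → ℕ, 1 ≤ ∑ i, α i → ∑ i, α i ≤ d → 0 ≤ cumulant P α)
    (α : Fin n → ℕ) (hα : ∑ i, α i ≤ d) : 0 ≤ multiMoment P α := by
  induction h : ∑ i, α i using Nat.strong_induction_on generalizing α with
  | _ N ih =>
    by_cases h0 : α = 0
    · simp [h0, multiMoment_zero]
    obtain ⟨i, hi⟩ := Function.ne_iff.mp h0
    obtain ⟨γ, rfl⟩ : ∃ γ, α = γ + Pi.single i 1 :=
      ⟨α - Pi.single i 1, (tsub_add_cancel_of_le <| update_le_iff.mpr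
        ⟨Nat.one_le_iff_ne_zero.mpr hi, fun _ _ => Nat.zero_le _⟩).symm⟩
    rw [sum_add_single] at h hα
    rw [multiMoment_add_single]
    refine sum_nonneg fun β hβ => ?_
    have hsum := sum_add_sum_sub (mem_Iic.mp hβ)
    refine mul_nonneg (Nat.cast_nonneg _) (mul_nonneg (hκ _ ?_ ?_) (ih _ ?_ _ ?_ rfl))
    · rw [sum_add_single]; omega
    · rw [sum_add_single]; omega
    · omega
    · omega

lemma cumulant_le_multiMoment
    (hκ : ∀ α : Fin n → ℕ, 1 ≤ ∑ i, α i → ∑ i, α i ≤ d → 0 ≤ cumulant P α)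
    (i : Fin n) {β : Fin n → ℕ} (hβ : ∑ j, β j < d) :
    cumulant P (β + Pi.single i 1) ≤ multiMoment P (β + Pi.single i 1) := by
  have hnonneg (γ : Fin n → ℕ) (hγ : γ ∈ Iic β) : 0 ≤ (multiBinom β γ : ℝ) *
      (cumulant P (γ + Pi.single i 1) * multiMoment P (β - γ)) := by
    have hsum := sum_add_sum_sub (mem_Iic.mp hγ)
    exact mul_nonneg (Nat.cast_nonneg _) (mul_nonneg (cumulant_add_single_nonneg hκ i (by omega))
      (multiMoment_nonneg hκ _ (by omega)))
  rw [multiMoment_add_single]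
  simpa [multiBinom_self, multiMoment_zero] using
    single_le_sum hnonneg (mem_Iic.mpr (le_refl β))

lemma cumulant_add_single_sq_le
    (hκ : ∀ α : Fin n → ℕ, 1 ≤ ∑ i, α i → ∑ i, α i ≤ d → 0 ≤ cumulant P α)
    (i : Fin n) {β : Fin n → ℕ} (hβ : ∑ j, β j < d) :
    cumulant P (β + Pi.single i 1) ^ 2 / multiFactorial β ≤
      multiMoment P (β + Pi.single i 1) ^ 2 / multiFactorial β :=
  div_le_div_of_nonneg_right (pow_le_pow_left₀ (cumulant_add_single_nonneg hκ i hβ)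
    (cumulant_le_multiMoment hκ i hβ) 2) (Nat.cast_nonneg _)

/-- At the top order the sign of the cumulant is unknown, so the recursion is solved for it. -/
lemma top_cumulant_sq_le
    (hκ : ∀ α : Fin n → ℕ, 1 ≤ ∑ i, α i → ∑ i, α i ≤ d → 0 ≤ cumulant P α)
    (i : Fin n) {α : Fin n → ℕ} (hα : ∑ j, α j = d) :
    cumulant P (α + Pi.single i 1) ^ 2 ≤ 2 * multiMoment P (α + Pi.single i 1) ^ 2 +
      2 * (∑ β ∈ Iio α, (multiBinom α β : ℝ) *
        (multiMoment P (β + Pi.single i 1) * multiMoment P (α - β))) ^ 2 := by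
  set S := ∑ β ∈ Iio α, (multiBinom α β : ℝ) *
    (cumulant P (β + Pi.single i 1) * multiMoment P (α - β)) with hS
  set T := ∑ β ∈ Iio α, (multiBinom α β : ℝ) *
    (multiMoment P (β + Pi.single i 1) * multiMoment P (α - β))
  have hlt {β : Fin n → ℕ} (hβ : β ∈ Iio α) : ∑ j, β j < d :=
    hα ▸ Fintype.sum_strictMono (mem_Iio.mp hβ)
  have hm (β : Fin n → ℕ) : 0 ≤ multiMoment P (α - β) :=
    multiMoment_nonneg hκ _ (hα ▸ Fintype.sum_mono tsub_le_self)
  have hrec : multiMoment P (α + Pi.single i 1) = cumulant P (α + Pi.single i 1) + S := by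
    rw [multiMoment_add_single, ← Iio_insert, sum_insert notMem_Iio_self]
    simp [multiMoment_zero, multiBinom_self, hS]
  have hS0 : 0 ≤ S := sum_nonneg fun β hβ => mul_nonneg (Nat.cast_nonneg _)
    (mul_nonneg (cumulant_add_single_nonneg hκ i (hlt hβ)) (hm β))
  have hST : S ≤ T := sum_le_sum fun β hβ => mul_le_mul_of_nonneg_left
    (mul_le_mul_of_nonneg_right (cumulant_le_multiMoment hκ i (hlt hβ)) (hm β))
    (Nat.cast_nonneg _)
  have hsq : S ^ 2 ≤ T ^ 2 := pow_le_pow_left₀ hS0 hST 2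
  rw [← sub_eq_of_eq_add hrec]
  nlinarith [sq_nonneg (multiMoment P (α + Pi.single i 1) + S)]

lemma sq_sum_multiBinom_mul_le {ι : Type*} [Fintype ι] [DecidableEq ι] (α : ι → ℕ)
    (F G : (ι → ℕ) → ℝ) :
    (∑ β ∈ Iio α, (multiBinom α β : ℝ) * (F β * G (α - β))) ^ 2 / multiFactorial α ≤
      2 ^ (∑ j, α j) * ∑ β ∈ Iio α,
        F β ^ 2 / multiFactorial β * (G (α - β) ^ 2 / multiFactorial (α - β)) := by
  have hfact (γ : ι → ℕ) : (multiFactorial γ : ℝ) ≠ 0 :=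
    Nat.cast_ne_zero.mpr (multiFactorial_ne_zero γ)
  have hbinom : ∑ β ∈ Iio α, (multiBinom α β : ℝ) ≤ 2 ^ (∑ j, α j) := by
    rw [← Nat.cast_sum]
    exact_mod_cast (sum_le_sum_of_subset Iio_subset_Iic_self).trans (sum_multiBinom α).le
  have hterm (β) (hβ : β ∈ Iio α) :
      (multiBinom α β : ℝ) * (F β ^ 2 * G (α - β) ^ 2) / multiFactorial α =
        F β ^ 2 / multiFactorial β * (G (α - β) ^ 2 / multiFactorial (α - β)) := by
    have h : (multiBinom α β : ℝ) * multiFactorial β * multiFactorial (α - β) =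
        multiFactorial α :=
      mod_cast multiBinom_mul_multiFactorial_mul (mem_Iio.mp hβ).le
    rw [div_mul_div_comm, div_eq_div_iff (hfact α) (mul_ne_zero (hfact β) (hfact _)), ← h]
    ring
  calc _ ≤ (∑ β ∈ Iio α, (multiBinom α β : ℝ)) *
          (∑ β ∈ Iio α, (multiBinom α β : ℝ) * (F β ^ 2 * G (α - β) ^ 2)) /
            multiFactorial α := by
        gcongr
        exact sum_sq_le_sum_mul_sum_of_sq_le_mul _ (fun β _ => by positivity)
          (fun β _ => by positivity) fun β _ => le_of_eq (by ring)
    _ ≤ 2 ^ (∑ j, α j) * (∑ β ∈ Iio α, (multiBinom α β : ℝ) * (F β ^ 2 * G (α - β) ^ 2)) /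
            multiFactorial α := by gcongr
    _ = _ := by rw [mul_div_assoc, sum_div, sum_congr rfl hterm]

lemma sum_top_cumulant_sq_le (hP : ∀ j, HasAllMoments (fun x => x j) P)
    (hκ : ∀ α : Fin n → ℕ, 1 ≤ ∑ i, α i → ∑ i, α i ≤ d → 0 ≤ cumulant P α) :
    ∑ i, ∑ α ∈ piAntidiag univ d, cumulant P (α + Pi.single i 1) ^ 2 / multiFactorial α ≤
      2 * (overlapMoment P (d + 1) / d.factorial) +
        2 * 2 ^ d * ∑ k ∈ range d, (overlapMoment P (k + 1) / k.factorial) *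
          (overlapMoment P (d - k) / (d - k).factorial) := by
  have hterm (i : Fin n) (α) (hα : α ∈ piAntidiag univ d) :
      cumulant P (α + Pi.single i 1) ^ 2 / multiFactorial α ≤
        2 * (multiMoment P (α + Pi.single i 1) ^ 2 / multiFactorial α) +
        2 * 2 ^ d * ∑ β ∈ Iio α, multiMoment P (β + Pi.single i 1) ^ 2 / multiFactorial β *
          (multiMoment P (α - β) ^ 2 / multiFactorial (α - β)) := by
    have hα := mem_piAntidiag_univ.mp hα
    have h := sq_sum_multiBinom_mul_le α (fun β => multiMoment P (β + Pi.single i 1))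
      (multiMoment P)
    rw [hα] at h
    refine (div_le_div_of_nonneg_right (top_cumulant_sq_le hκ i hα) (Nat.cast_nonneg _)).trans ?_
    rw [add_div, mul_div_assoc, mul_div_assoc, mul_assoc]
    gcongr
  refine (sum_le_sum fun i _ => sum_le_sum (hterm i)).trans (le_of_eq ?_)
  simp only [sum_add_distrib, ← mul_sum]
  rw [sum_sum_multiMoment_add_single_sq hP]
  simp only [sum_piAntidiag_sum_Iio d
    (fun β => multiMoment P (β + Pi.single _ 1) ^ 2 / multiFactorial β)
    (fun γ => multiMoment P γ ^ 2 / multiFactorial γ), sum_multiMoment_sq hP]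
  rw [sum_comm]
  simp only [← sum_mul, sum_sum_multiMoment_add_single_sq hP]

lemma lowDegreeCorr_sq_le_overlapMoment (hP : ∀ j, HasAllMoments (fun x => x j) P)
    (hκ : ∀ α : Fin n → ℕ, 1 ≤ ∑ i, α i → ∑ i, α i ≤ d → 0 ≤ cumulant P α)
    {lam : ℝ} (hlam : 0 ≤ lam) :
    lowDegreeCorr P d lam ^ 2 ≤
      ∑ k ∈ range d, lam ^ k * (overlapMoment P (k + 1) / k.factorial) +
      lam ^ d * (2 * (overlapMoment P (d + 1) / d.factorial) +
        2 * 2 ^ d * ∑ k ∈ range d, (overlapMoment P (k + 1) / k.factorial) *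
          (overlapMoment P (d - k) / (d - k).factorial)) := by
  have hdeg (k : ℕ) : ∑ i, ∑ β ∈ piAntidiag univ k,
      lam ^ (∑ j, β j) * cumulant P (β + Pi.single i 1) ^ 2 / multiFactorial β =
      lam ^ k * ∑ i, ∑ β ∈ piAntidiag univ k,
        cumulant P (β + Pi.single i 1) ^ 2 / multiFactorial β := by
    simp only [mul_sum]
    refine sum_congr rfl fun i _ => sum_congr rfl fun β hβ => ?_
    rw [mem_piAntidiag_univ.mp hβ, mul_div_assoc]
  refine (lowDegreeCorr_sq_le hP hlam d).trans ?_
  simp only [sum_multiIndicesLE]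
  rw [sum_comm, sum_range_succ]
  simp only [hdeg]
  gcongr with k hk
  · rw [← sum_sum_multiMoment_add_single_sq hP]
    exact sum_le_sum fun i _ => sum_le_sum fun β hβ =>
      cumulant_add_single_sq_le hκ i ((mem_piAntidiag_univ.mp hβ).trans_lt (mem_range.mp hk))
  · exact sum_top_cumulant_sq_le hP hκ

end NonnegativeCumulants

section MomentBounds

open Finset

variable {d : ℕ} {M : ℕ → ℝ} {lam q : ℝ}

lemma abs_div_factorial_le (x : ℝ) (m : ℕ) : |x / m.factorial| ≤ |x| := by
  rw [abs_div, Nat.abs_cast]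
  exact div_le_self (abs_nonneg _)
    (Nat.one_le_cast.mpr (Nat.one_le_iff_ne_zero.mpr m.factorial_ne_zero))

lemma sum_pow_mul_div_factorial_le (hlam : 0 ≤ lam) (hq : 0 ≤ q) (hlq : lam * q ≤ 1 / 100)
    (hM : ∀ k, 1 ≤ k → k ≤ d → |M k| ≤ 5 / 4 * q ^ k) :
    ∑ k ∈ range d, lam ^ k * (M (k + 1) / k.factorial) ≤ 125 / 99 * q := by
  have ht0 : 0 ≤ lam * q := mul_nonneg hlam hq
  calc _ ≤ ∑ k ∈ range d, lam ^ k * (5 / 4 * q ^ (k + 1)) := by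
        gcongr with k hk
        exact (le_abs_self _).trans <| (abs_div_factorial_le _ _).trans <|
          hM (k + 1) (by omega) (mem_range.mp hk)
    _ = 5 / 4 * q * ∑ k ∈ range d, (lam * q) ^ k := by
        rw [mul_sum]
        exact sum_congr rfl fun k _ => by ring
    _ ≤ 5 / 4 * q * (1 - lam * q)⁻¹ := by
        gcongr
        rw [← tsum_geometric_of_lt_one ht0 (by linarith)]
        exact (summable_geometric_of_lt_one ht0 (by linarith)).sum_le_tsum _
          fun k _ => by positivity
    _ ≤ 5 / 4 * q * (99 / 100)⁻¹ := by gcongr; linarith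
    _ = _ := by ring

lemma sum_div_factorial_mul_div_factorial_le (hq : 0 ≤ q)
    (hM : ∀ k, 1 ≤ k → k ≤ d → |M k| ≤ 5 / 4 * q ^ k) :
    ∑ k ∈ range d, (M (k + 1) / k.factorial) * (M (d - k) / (d - k).factorial) ≤
      2 ^ d * (25 / 16 * q ^ (d + 1)) := by
  have hM' (k m : ℕ) (h1 : 1 ≤ k) (h2 : k ≤ d) : |M k / m.factorial| ≤ 5 / 4 * q ^ k :=
    (abs_div_factorial_le _ _).trans (hM k h1 h2)
  have hterm (k) (hk : k ∈ range d) :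
      (M (k + 1) / k.factorial) * (M (d - k) / (d - k).factorial) ≤ 25 / 16 * q ^ (d + 1) := by
    have hk := mem_range.mp hk
    calc _ ≤ |M (k + 1) / k.factorial| * |M (d - k) / (d - k).factorial| := by
          rw [← abs_mul]
          exact le_abs_self _
      _ ≤ (5 / 4 * q ^ (k + 1)) * (5 / 4 * q ^ (d - k)) :=
          mul_le_mul (hM' _ _ (by omega) (by omega)) (hM' _ _ (by omega) (by omega))
            (abs_nonneg _) (by positivity)
      _ = 25 / 16 * q ^ (k + 1 + (d - k)) := by ring
      _ = _ := by rw [show k + 1 + (d - k) = d + 1 by omega]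
  calc _ ≤ ∑ k ∈ range d, 25 / 16 * q ^ (d + 1) := sum_le_sum hterm
    _ = d * (25 / 16 * q ^ (d + 1)) := by rw [sum_const, card_range, nsmul_eq_mul]
    _ ≤ _ := by
        gcongr
        exact_mod_cast Nat.lt_two_pow_self.le

lemma pow_mul_top_order_le (hd : 1 ≤ d) (hlam : 0 ≤ lam) (hq : 0 ≤ q)
    (hlq : lam * q ≤ 1 / 100) (hM : ∀ k, 1 ≤ k → k ≤ d + 1 → |M k| ≤ 5 / 4 * q ^ k) :
    lam ^ d * (2 * (M (d + 1) / d.factorial) + 2 * 2 ^ d * ∑ k ∈ range d,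
      (M (k + 1) / k.factorial) * (M (d - k) / (d - k).factorial)) ≤ 3 / 20 * q := by
  have ht0 : 0 ≤ lam * q := mul_nonneg hlam hq
  have htop : M (d + 1) / d.factorial ≤ 5 / 4 * q ^ (d + 1) :=
    (le_abs_self _).trans ((abs_div_factorial_le _ _).trans (hM (d + 1) (by omega) le_rfl))
  have hsum := sum_div_factorial_mul_div_factorial_le hq fun k h1 (h2 : k ≤ d) =>
    hM k h1 (Nat.le_succ_of_le h2)
  have hpow : (lam * q) ^ d ≤ 1 / 100 :=
    (pow_le_of_le_one ht0 (by linarith) (by omega)).trans hlq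
  have hpow4 : (4 * (lam * q)) ^ d ≤ 1 / 25 :=
    (pow_le_of_le_one (by positivity) (by linarith) (by omega)).trans (by linarith)
  calc _ ≤ lam ^ d * (2 * (5 / 4 * q ^ (d + 1)) +
        2 * 2 ^ d * (2 ^ d * (25 / 16 * q ^ (d + 1)))) := by gcongr
    _ = q * (5 / 2 * (lam * q) ^ d + 25 / 8 * (4 * (lam * q)) ^ d) := by
        rw [show (4 : ℝ) = 2 * 2 by norm_num]
        simp only [mul_pow, pow_succ]
        ring
    _ ≤ q * (3 / 20) := mul_le_mul_of_nonneg_left (by linarith) hq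
    _ = _ := mul_comm _ _

lemma lowDegreeCorr_sq_le_two_mul {n : ℕ} {P : Measure (Fin n → ℝ)} [IsProbabilityMeasure P]
    (hP : ∀ j, HasAllMoments (fun x => x j) P)
    (hκ : ∀ α : Fin n → ℕ, 1 ≤ ∑ i, α i → ∑ i, α i ≤ d → 0 ≤ cumulant P α) (hd : 1 ≤ d)
    (hlam : 0 ≤ lam) (hq : 0 ≤ q) (hlq : lam * q ≤ 1 / 100)
    (hM : ∀ k, 1 ≤ k → k ≤ d + 1 → |overlapMoment P k| ≤ 5 / 4 * q ^ k) :
    lowDegreeCorr P d lam ^ 2 ≤ 2 * q := by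
  have hlow := sum_pow_mul_div_factorial_le hlam hq hlq fun k h1 h2 =>
    hM k h1 (Nat.le_succ_of_le h2)
  have htop := pow_mul_top_order_le hd hlam hq hlq hM
  linarith [lowDegreeCorr_sq_le_overlapMoment hP hκ hlam]

end MomentBounds

section Quantiles

section Cdf

open Filter

variable {μ : Measure ℝ} {p : ℝ}

lemma bddBelow_setOf_le_cdf (hp : 0 < p) : BddBelow {y | p ≤ cdf μ y} := by
  obtain ⟨z, hz⟩ := ((tendsto_cdf_atBot μ).eventually (gt_mem_nhds hp)).exists
  exact ⟨z, fun y hy => le_of_not_ge fun hyz => (hz.trans_le hy).not_ge (monotone_cdf μ hyz)⟩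

lemma nonempty_setOf_le_cdf (hp : p < 1) : {y | p ≤ cdf μ y}.Nonempty := by
  obtain ⟨y, hy⟩ := ((tendsto_cdf_atTop μ).eventually (lt_mem_nhds hp)).exists
  exact ⟨y, hy.le⟩

lemma le_cdf_sInf (hp : p < 1) : p ≤ cdf μ (sInf {y | p ≤ cdf μ y}) := by
  refine ge_of_tendsto (((cdf μ).right_continuous _).mono Set.Ioi_subset_Ici_self) ?_
  filter_upwards [self_mem_nhdsWithin] with y hy
  obtain ⟨z, hz, hzy⟩ := exists_lt_of_csInf_lt (nonempty_setOf_le_cdf hp) hy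
  exact hz.trans (monotone_cdf μ hzy.le)

end Cdf

variable {n : ℕ} {P : Measure (Fin n → ℝ)}

lemma measurable_overlap : Measurable (overlap (n := n)) := by
  unfold overlap; fun_prop

variable [IsProbabilityMeasure P]

lemma overlapQuantile_eq_sInf_cdf (d : ℝ) : overlapQuantile P d =
    sInf {y | 1 - Real.exp (-d) ≤ cdf ((P.prod P).map fun x => |overlap x|) y} := by
  have : IsProbabilityMeasure ((P.prod P).map fun x => |overlap x|) :=
    Measure.isProbabilityMeasure_map measurable_overlap.abs.aemeasurable
  have habs (y : ℝ) : MeasurableSet {s : ℝ | |s| ≤ y} :=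
    measurableSet_le measurable_norm measurable_const
  have hlaw (y : ℝ) : (overlapLaw P).real {s | |s| ≤ y} =
      cdf ((P.prod P).map fun x => |overlap x|) y := by
    rw [cdf_eq_real, map_measureReal_apply measurable_overlap.abs measurableSet_Iic]
    exact map_measureReal_apply measurable_overlap (habs y)
  simp only [overlapQuantile, hlaw]

lemma overlapQuantile_mono {d e : ℝ} (hd : 0 < d) (hde : d ≤ e) :
    overlapQuantile P d ≤ overlapQuantile P e := by
  have hexp : Real.exp (-e) ≤ Real.exp (-d) := Real.exp_le_exp.mpr (neg_le_neg hde)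
  have hd1 : Real.exp (-d) < 1 := Real.exp_lt_one_iff.mpr (neg_lt_zero.mpr hd)
  rw [overlapQuantile_eq_sInf_cdf, overlapQuantile_eq_sInf_cdf]
  exact csInf_le_csInf (bddBelow_setOf_le_cdf (by linarith))
    (nonempty_setOf_le_cdf (by linarith [Real.exp_pos (-e)]))
    fun y hy => (sub_le_sub_left hexp 1).trans hy

lemma measureReal_overlapQuantile_lt_le (d : ℝ) :
    (P.prod P).real {x | overlapQuantile P d < |overlap x|} ≤ Real.exp (-d) := by
  have : IsProbabilityMeasure ((P.prod P).map fun x => |overlap x|) :=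
    Measure.isProbabilityMeasure_map measurable_overlap.abs.aemeasurable
  have h := le_cdf_sInf (μ := (P.prod P).map fun x => |overlap x|)
    (sub_lt_self 1 (Real.exp_pos (-d)))
  rw [← overlapQuantile_eq_sInf_cdf, cdf_eq_real,
    map_measureReal_apply measurable_overlap.abs measurableSet_Iic] at h
  have hcompl : {x : (Fin n → ℝ) × (Fin n → ℝ) | overlapQuantile P d < |overlap x|} =
      ((fun x => |overlap x|) ⁻¹' Set.Iic (overlapQuantile P d))ᶜ := by
    ext x; simp
  rw [hcompl, probReal_compl_eq_one_sub (measurable_overlap.abs measurableSet_Iic)]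
  linarith

end Quantiles

section Truncation

variable {Ω : Type*} [MeasurableSpace Ω] {μ : Measure Ω} [IsProbabilityMeasure μ] {X : Ω → ℝ}

lemma abs_integral_pow_le (hX : HasAllMoments X μ) (hXm : Measurable X) {q : ℝ} (hq : 0 ≤ q)
    (k : ℕ) :
    |∫ ω, X ω ^ k ∂μ| ≤ q ^ k + √(∫ ω, X ω ^ (2 * k) ∂μ) * √(μ.real {ω | q < |X ω|}) := by
  set s := {ω | q < |X ω|}
  have hs : MeasurableSet s := measurableSet_lt measurable_const hXm.abs
  have habs : HasAllMoments (fun ω => |X ω ^ k|) μ := fun p => (hX.pow k p).abs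
  have hind : HasAllMoments (s.indicator fun _ => (1 : ℝ)) μ := fun p =>
    (memLp_const 1).indicator hs
  have htail : ∫ ω, |X ω ^ k| * s.indicator (fun _ => (1 : ℝ)) ω ∂μ ≤
      √(∫ ω, X ω ^ (2 * k) ∂μ) * √(μ.real s) := by
    have hcs := sq_integral_mul_le (mod_cast habs 2) (mod_cast hind 2)
    have hsq (ω : Ω) : s.indicator (fun _ => (1 : ℝ)) ω ^ 2 = s.indicator 1 ω := by
      by_cases hω : ω ∈ s <;> simp [hω]
    simp only [hsq, sq_abs, ← pow_mul, mul_comm k 2, integral_indicator_one hs] at hcs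
    rw [← Real.sqrt_mul (integral_nonneg fun ω => (even_two_mul k).pow_nonneg _)]
    exact Real.le_sqrt_of_sq_le hcs
  calc |∫ ω, X ω ^ k ∂μ| ≤ ∫ ω, |X ω ^ k| ∂μ := abs_integral_le_integral_abs
    _ ≤ ∫ ω, (q ^ k + |X ω ^ k| * s.indicator (fun _ => (1 : ℝ)) ω) ∂μ := by
        refine integral_mono habs.integrable
          ((HasAllMoments.const _).add (habs.mul hind)).integrable fun ω => ?_
        by_cases hω : ω ∈ s
        · simp only [hω, Set.indicator_of_mem, mul_one]
          linarith [pow_nonneg hq k]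
        · simp only [hω, not_false_eq_true, Set.indicator_of_notMem, mul_zero, add_zero, abs_pow]
          exact pow_le_pow_left₀ (abs_nonneg _) (not_lt.mp hω) k
    _ = q ^ k + ∫ ω, |X ω ^ k| * s.indicator (fun _ => (1 : ℝ)) ω ∂μ := by
        rw [integral_add (integrable_const _) (habs.mul hind).integrable]
        simp
    _ ≤ _ := by gcongr

end Truncation

section SubWeibull

namespace IsSubWeibull

variable {Ω : Type*} [MeasurableSpace Ω] {μ : Measure Ω} [IsFiniteMeasure μ] {X : Ω → ℝ}
  {φ K : ℝ}

lemma hasAllMoments (h : IsSubWeibull φ K X μ) (hX : AEStronglyMeasurable X μ) :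
    HasAllMoments X μ := by
  intro p
  have hp : MemLp X (ENNReal.ofReal ((p : ℝ) + 1)) μ :=
    ⟨hX, (h _ (by linarith [p.cast_nonneg (α := ℝ)])).trans_lt ENNReal.ofReal_lt_top⟩
  refine hp.mono_exponent ?_
  rw [← ENNReal.ofReal_natCast]
  exact ENNReal.ofReal_le_ofReal (by linarith)

lemma integral_pow_le (h : IsSubWeibull φ K X μ) (hX : AEStronglyMeasurable X μ) (hK : 0 ≤ K)
    {k : ℕ} (hk : 1 ≤ k) :
    ∫ ω, X ω ^ (2 * k) ∂μ ≤ (K * (2 * k : ℝ) ^ (1 / φ)) ^ (2 * k) := by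
  have hk' : (1 : ℝ) ≤ k := by exact_mod_cast hk
  have hpos : (0 : ℝ) < 2 * k := by linarith
  have hB : 0 ≤ K * (2 * k : ℝ) ^ (1 / φ) := by positivity
  have hmem : MemLp X (ENNReal.ofReal (2 * k)) μ := by
    have := h.hasAllMoments hX (2 * k)
    rwa [← ENNReal.ofReal_natCast, Nat.cast_mul, Nat.cast_ofNat] at this
  have hnorm (x : ℝ) : ‖x‖ ^ (2 * k : ℝ) = x ^ (2 * k) := by
    rw [← Nat.cast_ofNat, ← Nat.cast_mul, Real.rpow_natCast, Real.norm_eq_abs,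
      (even_two_mul k).pow_abs]
  have hint : 0 ≤ ∫ ω, X ω ^ (2 * k) ∂μ := integral_nonneg fun ω => (even_two_mul k).pow_nonneg _
  have hLp := h (2 * k) (by linarith)
  rw [hmem.eLpNorm_eq_integral_rpow_norm (ENNReal.ofReal_pos.mpr hpos).ne'
    ENNReal.ofReal_ne_top, ENNReal.ofReal_le_ofReal_iff hB, ENNReal.toReal_ofReal hpos.le] at hLp
  simp only [hnorm] at hLp
  rw [Real.rpow_inv_le_iff_of_pos hint hB hpos] at hLp
  rwa [← Real.rpow_natCast, Nat.cast_mul, Nat.cast_ofNat]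

end IsSubWeibull

end SubWeibull

section OverlapMomentBounds

lemma sum_pow_two_mul_le {n : ℕ} (hn : 1 ≤ n) (a : Fin n → ℝ) {k : ℕ} (hk : 1 ≤ k) :
    (∑ i, a i) ^ (2 * k) ≤ n ^ (2 * k - 1) * ∑ i, a i ^ (2 * k) := by
  have : (0 : ℝ) < n := by exact_mod_cast hn
  have h := pow_sum_div_card_le_sum_pow (s := Finset.univ) (f := fun i => |a i|)
    (fun i _ => abs_nonneg _) (2 * k - 1)
  rw [Finset.card_univ, Fintype.card_fin, div_le_iff₀ (by positivity),
    Nat.sub_add_cancel (by omega)] at h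
  calc (∑ i, a i) ^ (2 * k) = |∑ i, a i| ^ (2 * k) := ((even_two_mul k).pow_abs _).symm
    _ ≤ (∑ i, |a i|) ^ (2 * k) := by gcongr; exact Finset.abs_sum_le_sum_abs _ _
    _ ≤ _ := h
    _ = _ := by rw [mul_comm]; simp only [(even_two_mul k).pow_abs]

variable {n : ℕ} {P : Measure (Fin n → ℝ)} [IsProbabilityMeasure P]

lemma overlapMoment_two_mul_le (hP : ∀ j, HasAllMoments (fun x => x j) P) (hn : 1 ≤ n) {B : ℝ}
    {k : ℕ} (hk : 1 ≤ k) (hB : ∀ i, ∫ x, x i ^ (2 * k) ∂P ≤ B ^ (2 * k)) :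
    overlapMoment P (2 * k) ≤ ((n * B ^ 2) ^ k) ^ 2 := by
  have hpow (i : Fin n) : HasAllMoments (fun x : (Fin n → ℝ) × (Fin n → ℝ) =>
      x.1 i ^ (2 * k) * x.2 i ^ (2 * k)) (P.prod P) :=
    (((hP i).pow _).comp measurePreserving_fst).mul (((hP i).pow _).comp measurePreserving_snd)
  have hpt (x : (Fin n → ℝ) × (Fin n → ℝ)) : overlap x ^ (2 * k) ≤
      n ^ (2 * k - 1) * ∑ i, x.1 i ^ (2 * k) * x.2 i ^ (2 * k) := by
    simpa only [overlap, mul_pow] using sum_pow_two_mul_le hn (fun i => x.1 i * x.2 i) hk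
  calc overlapMoment P (2 * k)
      ≤ ∫ x, (n : ℝ) ^ (2 * k - 1) * ∑ i, x.1 i ^ (2 * k) * x.2 i ^ (2 * k) ∂P.prod P :=
        integral_mono ((hasAllMoments_overlap hP).pow _).integrable
          ((HasAllMoments.sum fun i _ => hpow i).const_mul _).integrable hpt
    _ = (n : ℝ) ^ (2 * k - 1) * ∑ i, (∫ x, x i ^ (2 * k) ∂P) ^ 2 := by
        rw [integral_const_mul, integral_finsetSum _ fun i _ => (hpow i).integrable]
        congr! 2 with i
        rw [integral_prod_mul (fun x : Fin n → ℝ => x i ^ (2 * k))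
          (fun x : Fin n → ℝ => x i ^ (2 * k)), sq]
    _ ≤ (n : ℝ) ^ (2 * k - 1) * ∑ i : Fin n, (B ^ (2 * k)) ^ 2 := by
        gcongr with i _
        · exact integral_nonneg fun x => (even_two_mul k).pow_nonneg _
        · exact hB i
    _ = n ^ (2 * k - 1 + 1) * (B ^ (2 * k)) ^ 2 := by
        rw [Finset.sum_const, Finset.card_univ, Fintype.card_fin, nsmul_eq_mul, ← mul_assoc,
          ← pow_succ]
    _ = ((n * B ^ 2) ^ k) ^ 2 := by
        rw [Nat.sub_add_cancel (by omega)]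
        ring

lemma abs_overlapMoment_le (hP : ∀ j, HasAllMoments (fun x => x j) P) (hn : 1 ≤ n) {B : ℝ}
    {k : ℕ} (hk : 1 ≤ k) (hB : ∀ i, ∫ x, x i ^ (2 * k) ∂P ≤ B ^ (2 * k)) {d : ℝ}
    (hq : 0 ≤ overlapQuantile P d) :
    |overlapMoment P k| ≤ overlapQuantile P d ^ k + (n * B ^ 2) ^ k * Real.exp (-d / 2) := by
  have hmom : √(overlapMoment P (2 * k)) ≤ (n * B ^ 2) ^ k :=
    (Real.sqrt_le_left (by positivity)).mpr (overlapMoment_two_mul_le hP hn hk hB)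
  have htail : √((P.prod P).real {x | overlapQuantile P d < |overlap x|}) ≤ Real.exp (-d / 2) := by
    rw [Real.exp_half]
    exact Real.sqrt_le_sqrt (measureReal_overlapQuantile_lt_le d)
  refine (abs_integral_pow_le (hasAllMoments_overlap hP) measurable_overlap hq k).trans ?_
  gcongr
  exact hmom

lemma mul_sq_rpow_le {φ K C C₁ x m q : ℝ} (hφ : 0 < φ) (hK : 0 ≤ K) (hx : 0 < x) (hm0 : 0 ≤ m)
    (hm : m ≤ 4 * x ^ C) (hxK : (K * 4 ^ (1 / φ)) ^ 2 ≤ x) (hq : x ^ (-C₁) ≤ q) :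
    x * (K * m ^ (1 / φ)) ^ 2 ≤ x ^ (2 + C₁ + 2 * (C / φ)) * q := by
  have hmx : K * m ^ (1 / φ) ≤ K * 4 ^ (1 / φ) * x ^ (C / φ) := by
    calc K * m ^ (1 / φ) ≤ K * (4 * x ^ C) ^ (1 / φ) := by gcongr
      _ = _ := by
        rw [Real.mul_rpow (by norm_num) (by positivity), ← Real.rpow_mul hx.le, mul_one_div]
        ring
  calc x * (K * m ^ (1 / φ)) ^ 2 ≤ x * (K * 4 ^ (1 / φ) * x ^ (C / φ)) ^ 2 := by gcongr
    _ = (K * 4 ^ (1 / φ)) ^ 2 * (x * (x ^ (C / φ)) ^ 2) := by ring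
    _ ≤ x * (x * (x ^ (C / φ)) ^ 2) := by gcongr
    _ = x ^ (2 + C₁ + 2 * (C / φ)) * x ^ (-C₁) := by
      rw [← Real.rpow_add hx, ← Real.rpow_mul_natCast hx.le, ← mul_assoc, ← sq,
        ← Real.rpow_natCast x 2, ← Real.rpow_add hx]
      congr 1
      push_cast
      ring
    _ ≤ _ := by gcongr

lemma rpow_pow_mul_exp_le {c x d : ℝ} (hc : 0 ≤ c) (hx : 0 < x) (hd : 1 ≤ d)
    (hlog : 4 * c + 4 ≤ Real.log x) {k : ℕ} (hk : k ≤ 2 * d) :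
    (x ^ c) ^ k * Real.exp (-(d * Real.log x ^ 2) / 2) ≤ 1 / 4 := by
  have hL : 1 ≤ Real.log x := by linarith
  have hexponent : k * (Real.log x * c) + -(d * Real.log x ^ 2) / 2 ≤ -2 := by
    calc k * (Real.log x * c) + -(d * Real.log x ^ 2) / 2
        ≤ 2 * d * (Real.log x * c) + -(d * Real.log x ^ 2) / 2 := by gcongr
      _ = d * Real.log x * (2 * c - Real.log x / 2) := by ring
      _ ≤ d * Real.log x * (-2) := by gcongr; linarith
      _ ≤ -2 := by nlinarith
  have hexp2 : Real.exp (-2) ≤ 1 / 4 := by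
    rw [Real.exp_neg, one_div]
    refine inv_anti₀ (by norm_num) ?_
    rw [show (2 : ℝ) = 1 + 1 by norm_num, Real.exp_add]
    nlinarith [Real.add_one_le_exp 1]
  rw [Real.rpow_def_of_pos hx, ← Real.exp_nat_mul, ← Real.exp_add]
  exact (Real.exp_le_exp.mpr hexponent).trans hexp2

lemma abs_overlapMoment_le_of_isSubWeibull {φ K C C₁ : ℝ} (hφ : 0 < φ) (hK : 0 ≤ K)
    (hC : 0 ≤ C) (hC₁ : 0 ≤ C₁) (hsw : ∀ i, IsSubWeibull φ K (fun x : Fin n → ℝ => x i) P)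
    {d : ℕ} (hd : 1 ≤ d) (hdC : (d : ℝ) ≤ (n : ℝ) ^ C)
    (hq : (n : ℝ) ^ (-C₁) ≤ overlapQuantile P (d * Real.log n ^ 2))
    (hnK : (K * 4 ^ (1 / φ)) ^ 2 ≤ n) (hlog : 4 * (2 + C₁ + 2 * (C / φ)) + 4 ≤ Real.log n)
    {k : ℕ} (hk : 1 ≤ k) (hkd : k ≤ d + 1) :
    |overlapMoment P k| ≤ 5 / 4 * overlapQuantile P (d * Real.log n ^ 2) ^ k := by
  have hmeas (i : Fin n) : AEStronglyMeasurable (fun x : Fin n → ℝ => x i) P :=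
    (measurable_pi_apply i).aestronglyMeasurable
  have hc : 0 ≤ 2 + C₁ + 2 * (C / φ) := by positivity
  have hn1 : 1 < (n : ℝ) := (Real.log_pos_iff n.cast_nonneg).mp (by linarith)
  have hn0 : 0 < (n : ℝ) := by linarith
  have hd1 : (1 : ℝ) ≤ d := by exact_mod_cast hd
  have hkd' : (k : ℝ) ≤ d + 1 := by exact_mod_cast hkd
  set q := overlapQuantile P (d * Real.log n ^ 2)
  have hq0 : 0 < q := (Real.rpow_pos_of_pos hn0 _).trans_le hq
  have htrunc := abs_overlapMoment_le (fun i => (hsw i).hasAllMoments (hmeas i))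
    (Nat.one_le_cast.mp hn1.le) hk (fun i => (hsw i).integral_pow_le (hmeas i) hK hk) hq0.le
  have hbase := mul_sq_rpow_le (C := C) hφ hK hn0 (m := 2 * k) (by positivity) (by linarith) hnK hq
  have hexp := rpow_pow_mul_exp_le hc hn0 hd1 hlog (k := k) (by linarith)
  have hrest : (n * (K * (2 * k : ℝ) ^ (1 / φ)) ^ 2) ^ k *
      Real.exp (-(d * Real.log n ^ 2) / 2) ≤ 1 / 4 * q ^ k := by
    calc _ ≤ ((n : ℝ) ^ (2 + C₁ + 2 * (C / φ)) * q) ^ k *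
            Real.exp (-(d * Real.log n ^ 2) / 2) := by gcongr
      _ = ((n : ℝ) ^ (2 + C₁ + 2 * (C / φ))) ^ k *
            Real.exp (-(d * Real.log n ^ 2) / 2) * q ^ k := by rw [mul_pow]; ring
      _ ≤ _ := by gcongr
  linarith

lemma lowDegreeCorr_sq_le_two_mul_overlapQuantile {φ K C C₁ : ℝ} (hφ : 0 < φ) (hK : 0 ≤ K)
    (hC : 0 ≤ C) (hC₁ : 0 ≤ C₁) (hsw : ∀ i, IsSubWeibull φ K (fun x : Fin n → ℝ => x i) P)
    {d : ℕ} (hd : 1 ≤ d) (hdC : (d : ℝ) ≤ (n : ℝ) ^ C)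
    (hκ : ∀ α : Fin n → ℕ, 1 ≤ ∑ i, α i → ∑ i, α i ≤ d → 0 ≤ cumulant P α)
    (hq : (n : ℝ) ^ (-C₁) ≤ overlapQuantile P (d * Real.log n ^ 2))
    (hnK : (K * 4 ^ (1 / φ)) ^ 2 ≤ n) (hlog : 4 * (2 + C₁ + 2 * (C / φ)) + 4 ≤ Real.log n)
    {lam : ℝ} (hlam : 0 ≤ lam) (hlq : lam * overlapQuantile P (d * Real.log n ^ 2) ≤ 1 / 100) :
    lowDegreeCorr P d lam ^ 2 ≤ 2 * overlapQuantile P (d * Real.log n ^ 2) :=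
  lowDegreeCorr_sq_le_two_mul
    (fun i => (hsw i).hasAllMoments (measurable_pi_apply i).aestronglyMeasurable) hκ hd hlam
    ((Real.rpow_nonneg n.cast_nonneg _).trans hq) hlq fun _ hk hkd =>
      abs_overlapMoment_le_of_isSubWeibull hφ hK hC hC₁ hsw hd hdC hq hnK hlog hk hkd

end OverlapMomentBounds

section FranzParisi

lemma deriv_annealedFP {f : ℝ → ℝ} {q : ℝ} (u : ℝ) (hf : 0 < f q)
    (hd : DifferentiableAt ℝ f q) :
    deriv (annealedFP f u) q = -u - deriv (fun t => Real.log (f t)) q := by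
  have hexp : HasDerivAt (fun t => Real.exp (u * t)) (Real.exp (u * q) * u) q := by
    simpa using ((hasDerivAt_id q).const_mul u).exp
  have hFP := ((hexp.mul hd.hasDerivAt).log
    (mul_ne_zero (Real.exp_pos (u * q)).ne' hf.ne')).neg
  have hFP' : HasDerivAt (annealedFP f u) _ q := hFP
  rw [hFP'.deriv, (hd.hasDerivAt.log hf.ne').deriv]
  have := (Real.exp_pos (u * q)).ne'
  simp only [Pi.mul_apply]
  field_simp
  ring

lemma one_div_mul_mul_le {A q L x : ℝ} (hA : 0 < A) (hq : 0 < q) (hL : 100 ≤ L)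
    (hx : x ≤ A / (q * L)) : 1 / A * x * q ≤ 1 / 100 := by
  have : 0 < L := by linarith
  calc 1 / A * x * q ≤ 1 / A * (A / (q * L)) * q := by gcongr
    _ = 1 / L := by field_simp
    _ ≤ 1 / 100 := one_div_le_one_div_of_le (by norm_num) hL

end FranzParisi

end GaussianAdditive

open GaussianAdditive in
theorem theorem2p4_general
    (P : ∀ n : ℕ, MeasureTheory.Measure (Fin n → ℝ))
    (hP : ∀ n, MeasureTheory.IsProbabilityMeasure (P n))
    (f : ℕ → ℝ → ℝ) (D : ℕ → ℕ) (D' A : ℕ → ℝ) {φ K C C₁ : ℝ}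
    (hφ : 0 < φ) (hK : 0 ≤ K) (hC : 0 ≤ C) (hC₁ : 0 ≤ C₁)
    (hf : HasRegularOverlapPDF P f D)
    (hD : ∀ᶠ n in Filter.atTop, 0 < D n)
    (hDC : ∀ᶠ n : ℕ in Filter.atTop, (D n : ℝ) ≤ (n : ℝ) ^ C)
    (hD' : ∀ᶠ n : ℕ in Filter.atTop, (D n : ℝ) * Real.log n ^ 2 ≤ D' n)
    (hA : ∀ᶠ n in Filter.atTop, 0 < A n)
    (hκ : ∀ᶠ n : ℕ in Filter.atTop, ∀ α : Fin n → ℕ, 1 ≤ ∑ i, α i → ∑ i, α i ≤ D n →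
      0 ≤ cumulant (P n) α)
    (hsw : ∀ᶠ n : ℕ in Filter.atTop, ∀ i : Fin n,
      IsSubWeibull φ K (fun x : Fin n → ℝ => x i) (P n))
    (hdecay : ∀ᶠ n : ℕ in Filter.atTop,
      (n : ℝ) ^ (-C₁) ≤ overlapQuantile (P n) (D n * Real.log n ^ 2))
    (hstab : ∀ᶠ n : ℕ in Filter.atTop,
      -(A n / (overlapQuantile (P n) (D n * Real.log n ^ 2) * Real.log n)) ≤
        deriv (fun t => Real.log (f n t)) (overlapQuantile (P n) (D n))) :
    ∀ᶠ n : ℕ in Filter.atTop,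
      (∀ u : ℝ, 0 ≤ u + deriv (annealedFP (f n) u) (overlapQuantile (P n) (D n)) →
        lowDegreeCorr (P n) (D n)
            (1 / A n * (u + deriv (annealedFP (f n) u) (overlapQuantile (P n) (D n)))) ^ 2 ≤
          2 * overlapQuantile (P n) (D' n)) ∧
      (∀ lam : ℝ, 0 ≤ lam → 0 ≤ deriv (annealedFP (f n) lam) (overlapQuantile (P n) (D n)) →
        lowDegreeCorr (P n) (D n) (1 / A n * lam) ^ 2 ≤ 2 * overlapQuantile (P n) (D' n)) := by
  have hn : Filter.Tendsto (fun n : ℕ => (n : ℝ)) Filter.atTop Filter.atTop :=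
    tendsto_natCast_atTop_atTop
  have hlog := Real.tendsto_log_atTop.comp hn
  filter_upwards [hf, hD, hDC, hD', hA, hκ, hsw, hdecay, hstab,
    hn.eventually_gt_atTop 0, hn.eventually_ge_atTop ((K * 4 ^ (1 / φ)) ^ 2),
    hlog.eventually_ge_atTop (4 * (2 + C₁ + 2 * (C / φ)) + 4), hlog.eventually_ge_atTop 100]
    with n ⟨_, hfpos, hfdiff⟩ hD hDC hD' hA hκ hsw hdecay hstab hn0 hnK hlogc hlog100
  set L := Real.log n
  have hL : 100 ≤ L := hlog100
  have hq : 0 < overlapQuantile (P n) (D n * L ^ 2) := (Real.rpow_pos_of_pos hn0 _).trans_le hdecay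
  have hcorr {x : ℝ} (hx : 0 ≤ x)
      (hxf : x ≤ -deriv (fun t => Real.log (f n t)) (overlapQuantile (P n) (D n))) :
      lowDegreeCorr (P n) (D n) (1 / A n * x) ^ 2 ≤ 2 * overlapQuantile (P n) (D' n) := by
    have hscale := one_div_mul_mul_le hA hq hL (x := x) (by linarith)
    have hmono : overlapQuantile (P n) (D n * L ^ 2) ≤ overlapQuantile (P n) (D' n) :=
      overlapQuantile_mono (by positivity) hD'
    have := lowDegreeCorr_sq_le_two_mul_overlapQuantile hφ hK hC hC₁ hsw hD hDC hκ hdecay hnK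
      hlogc (by positivity) hscale
    linarith
  simp only [deriv_annealedFP _ hfpos hfdiff]
  exact ⟨fun u hu => hcorr hu (by linarith), fun lam hlam hu => hcorr hlam (by linarith)⟩

theorem theorem2p4
    (P : ∀ n : ℕ, MeasureTheory.Measure (Fin n → ℝ))
    (hP : ∀ n, MeasureTheory.IsProbabilityMeasure (P n))
    (f : ℕ → ℝ → ℝ) (D D' : ℕ → ℕ) (A : ℕ → ℝ) (C : ℝ)
    (hf : GaussianAdditive.HasRegularOverlapPDF P f D)
    (hGAM : GaussianAdditive.IsLowOrderCumulantNonneg P f D A C)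
    (hD'_asymp : Asymptotics.IsEquivalent Filter.atTop
      (fun n : ℕ => (D' n : ℝ)) (fun n : ℕ => (D n : ℝ) * Real.log n ^ 2))
    (hD'_ge : ∀ᶠ n : ℕ in Filter.atTop, (D n : ℝ) * Real.log n ^ 2 ≤ (D' n : ℝ)) :
    (∀ᶠ n : ℕ in Filter.atTop, ∀ u : ℝ, 0 < u →
      0 < u + deriv (GaussianAdditive.annealedFP (f n) u)
        (GaussianAdditive.overlapQuantile (P n) (D n)) →
      GaussianAdditive.lowDegreeCorr (P n) (D n)
          (1 / A n * (u + deriv (GaussianAdditive.annealedFP (f n) u)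
            (GaussianAdditive.overlapQuantile (P n) (D n)))) ^ 2 ≤
        2 * GaussianAdditive.overlapQuantile (P n) (D' n)) ∧
    (∀ lam : ℕ → ℝ, (∀ n, 0 < lam n) → ∀ᶠ n : ℕ in Filter.atTop,
      0 ≤ deriv (GaussianAdditive.annealedFP (f n) (lam n))
        (GaussianAdditive.overlapQuantile (P n) (D n)) →
      GaussianAdditive.lowDegreeCorr (P n) (D n) (1 / A n * lam n) ^ 2 ≤
        2 * GaussianAdditive.overlapQuantile (P n) (D' n)) := by
  obtain ⟨φ, hφ, K, hK, hsw⟩ := hGAM.subWeibull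
  obtain ⟨C₁, hC₁, hdecay⟩ := hGAM.quantile_decay
  have h := theorem2p4_general P hP f D (fun n => D' n) A hφ hK.le hGAM.C_pos.le hC₁.le hf
    (.of_forall hGAM.D_pos) hGAM.D_le hD'_ge (.of_forall hGAM.A_pos) hGAM.cumulant_nonneg hsw
    (hdecay.mono fun n hn => (le_max_right _ _).trans hn) hGAM.quantile_stability
  exact ⟨h.mono fun n hn u _ hu => hn.1 u hu.le,
    fun lam hlam => h.mono fun n hn => hn.2 (lam n) (hlam n).le⟩
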